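/- Let $M$ be a closed (compact, without boundary) smooth Riemannian manifold with Riemannian volume $\mu$. Let $\mathrm{Diff}(M)$ be the group of smooth diffeomorphisms of $M$, let $\mathrm{Jac}_\mu\eta$ be the positive function with $\eta^*\mu=(\mathrm{Jac}_\mu\eta)\,\mu$ (as densities), let $\mathrm{Diff}_\mu(M)=\{\xi:\xi^*\mu=\mu\}$, and let $\mathrm{Dens}(M)=\mathrm{Diff}(M)/\mathrm{Diff}_\mu(M)$ be the space of right cosets $\mathrm{Diff}_\mu(M)\,\eta$. The coset of $\eta$ is identified with its density $\rho=\mathrm{Jac}_\mu\eta$, a smooth positive function with $\int_M\rho\,d\mu=\mu(M)$ (a probability density when $\mu(M)=1$); a tangent vector of $\mathrm{Dens}(M)$ at this coset is the variation $\alpha$ of the density along a smooth curve in $\mathrm{Diff}(M)$ through $\eta$, and if the curve has velocity $u\circ\eta$ at $\eta$, with $u$ a smooth vector field, we say that $u\circ\eta$ is a lift of $\alpha$. A map from an open set $E\subset\mathbb{R}^k$ to $\mathrm{Dens}(M)$ is called smooth if near each point of $E$ it is the projection of a smooth family of diffeomorphisms. Consider on $\mathrm{Diff}(M)$ the right-invariant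 $\dot H^1$ metric $$\langle\!\langle u\circ\eta,v\circ\eta\rangle\!\rangle_{\dot H^1}=\frac14\int_M \operatorname{div}u\cdot\operatorname{div}v\,d\mu .$$ Then: (1) The $\dot H^1$ metric descends to $\mathrm{Dens}(M)$: for $\alpha,\beta$ tangent to $\mathrm{Dens}(M)$ at $p$, the number $\langle\!\langle\alpha,\beta\rangle\!\rangle_{\dot H^1,p}=\langle\!\langle u\circ\eta,v\circ\eta\rangle\!\rangle_{\dot H^1}$ does not depend on the choice of $\eta$ over $p$ and of lifts $u\circ\eta$, $v\circ\eta$ of $\alpha$, $\beta$. (2) Let $k\ge 0$, let $E\subset\mathbb{R}^k$ be open and let $s\mapsto\rho_s$ be a smooth map from $E$ to $\mathrm{Dens}(M)$ (in particular, a local parametrization of a $k$-dimensional statistical submanifold of $\mathrm{Dens}(M)$). Then $\rho_s(x)$ is smooth on $E\times M$ and positive with $\int_M\rho_s\,d\mu=\mu(M)$, its directional derivatives $\partial_a\rho_s$ are tangent to $\mathrm{Dens}(M)$, and the Fisher–Rao information metric $$I_{ij}(s)=\int_M\frac{\partial\log\rho_s}{\partial s_i}\,\frac{\partial\log\rho_s}{\partial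 s_j}\,\rho_s\,d\mu$$ is $4$ times the induced $\dot H^1$ metric: for all $s\in E$ and $a,b\in\mathbb{R}^k$, $$\sum_{i,j=1}^k I_{ij}(s)\,a_i b_j=4\,\langle\!\langle\partial_a\rho_s,\partial_b\rho_s\rangle\!\rangle_{\dot H^1,\rho_s}.$$ (3) More generally, let $\rho_s(x)$, $s\in E$, be any smooth family of positive densities with $\int_M\rho_s\,d\mu=\mu(M)$. Then the last identity holds for all $s\in E$ and $a,b\in\mathbb{R}^k$ such that $\rho_s=\mathrm{Jac}_\mu\eta$ for some $\eta\in\mathrm{Diff}(M)$ and $\partial_a\rho_s$, $\partial_b\rho_s$ have lifts at a common such $\eta$. -/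

import Mathlib

open MeasureTheory Set
open scoped Manifold ContDiff Topology

noncomputable section

namespace DensityGeometry

/-- The group `Diff(M)` of smooth diffeomorphisms of `M`. -/
abbrev Diff (n : ℕ) (M : Type*) [TopologicalSpace M]
    [ChartedSpace (EuclideanSpace ℝ (Fin n)) M] : Type _ :=
  Diffeomorph (𝓡 n) (𝓡 n) M M ∞

/-- A smooth Riemannian metric on `M`. -/
abbrev Metric (n : ℕ) (M : Type*) [TopologicalSpace M]
    [ChartedSpace (EuclideanSpace ℝ (Fin n)) M] [IsManifold (𝓡 n) ∞ M] : Type _ :=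
  Bundle.ContMDiffRiemannianMetric (𝓡 n) ∞ (EuclideanSpace ℝ (Fin n))
    (fun x : M => TangentSpace (𝓡 n) x)

section Topological

variable {n : ℕ} {M : Type*} [TopologicalSpace M] [ChartedSpace (EuclideanSpace ℝ (Fin n)) M]

/-- The product of two diffeomorphisms is their composition, `(η * ξ) x = η (ξ x)`. -/
instance instGroupDiff : Group (Diff n M) where
  mul η ξ := ξ.trans η
  one := Diffeomorph.refl (𝓡 n) M ∞
  inv η := η.symm
  mul_assoc _ _ _ := rfl
  one_mul _ := rfl
  mul_one _ := rfl
  inv_mul_cancel η := by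
    apply DFunLike.ext
    intro x
    exact η.symm_apply_apply x

theorem Diff.mul_apply (η ξ : Diff n M) (x : M) : (η * ξ) x = η (ξ x) := rfl

theorem Diff.one_apply (x : M) : (1 : Diff n M) x = x := rfl

/-- The basis of the tangent space at `x` given by the preferred chart at `x`. -/
def stdFrame (x : M) (i : Fin n) : TangentSpace (𝓡 n) x :=
  (EuclideanSpace.single i (1 : ℝ) : EuclideanSpace ℝ (Fin n))

/-- A map `η` from an open subset `U` of a normed space to `Diff(M)` is smooth when
`(s, x) ↦ η s x` is smooth on `U × M`. -/
def SmoothFamilyOn {F : Type*} [NormedAddCommGroup F] [NormedSpace ℝ F]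
    (η : F → Diff n M) (U : Set F) : Prop :=
  ContMDiffOn (𝓘(ℝ, F).prod (𝓡 n)) (𝓡 n) ∞ (fun q : F × M => η q.1 q.2) (U ×ˢ univ)

/-- Smooth vector fields on `M`, the elements of the tangent space `T_e Diff(M)`. -/
def IsSmoothField [IsManifold (𝓡 n) ∞ M] (u : (x : M) → TangentSpace (𝓡 n) x) : Prop :=
  ContMDiff (𝓡 n) (𝓡 n).tangent ∞ (fun x => (⟨x, u x⟩ : TangentBundle (𝓡 n) M))

/-- The curve `c` in `Diff(M)` is smooth near `t = 0`, with `c 0 = η` and velocity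
`u ∘ η ∈ T_η Diff(M)` at `t = 0`. -/
def IsCurveWithVelocity (c : ℝ → Diff n M) (η : Diff n M)
    (u : (x : M) → TangentSpace (𝓡 n) x) : Prop :=
  (∃ U : Set ℝ, IsOpen U ∧ 0 ∈ U ∧ SmoothFamilyOn c U) ∧ c 0 = η ∧
    ∀ x : M, HasMFDerivAt 𝓘(ℝ, ℝ) (𝓡 n) (fun t : ℝ => c t x) 0
      (ContinuousLinearMap.toSpanSingleton ℝ (u (c 0 x)))

end Topological

section Riemannian

variable {n : ℕ} {M : Type*} [TopologicalSpace M] [ChartedSpace (EuclideanSpace ℝ (Fin n)) M]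
  [IsManifold (𝓡 n) ∞ M]

/-- The Riemannian volume density at `x` on an `n`-tuple of tangent vectors:
`|μ_x(v₁, …, vₙ)| = √ det (g_x(vᵢ, vⱼ))`. -/
def volDensity (g : Metric n M) (x : M) (v : Fin n → TangentSpace (𝓡 n) x) : ℝ :=
  Real.sqrt (Matrix.det (Matrix.of fun i j => g.inner x (v i) (v j)))

/-- The Jacobian `Jac_μ η`, defined by `η^* μ = (Jac_μ η) μ`; both densities are evaluated on a
basis of the tangent space at `x`. -/
def jac (g : Metric n M) (η : Diff n M) (x : M) : ℝ :=
  volDensity g (η x) (fun i => mfderiv (𝓡 n) (𝓡 n) η x (stdFrame x i)) /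
    volDensity g x (stdFrame x)

/-- The function `√ det g` in the coordinates of the chart around `x₀`, at the point with
coordinates `z`. -/
def chartDensity (g : Metric n M) (x₀ : M) (z : EuclideanSpace ℝ (Fin n)) : ℝ :=
  volDensity g ((extChartAt (𝓡 n) x₀).symm z) (fun i =>
    mfderiv (𝓡 n) (𝓡 n) (extChartAt (𝓡 n) x₀).symm z (stdFrame z i))

/-- The measure `√ det g dz` on the domain of the chart around `x₀`, extended by zero. -/
def chartVolume [MeasurableSpace M] (g : Metric n M) (x₀ : M) : Measure M :=
  (((volume : Measure (EuclideanSpace ℝ (Fin n))).restrict (extChartAt (𝓡 n) x₀).target).withDensity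
    (fun z => ENNReal.ofReal (chartDensity g x₀ z))).map (extChartAt (𝓡 n) x₀).symm

/-- The Riemannian volume `μ`: the least measure that dominates `√ det g dz` in every chart. Since
these chart measures agree on overlaps, it restricts to each of them on the chart's domain. -/
def riemVol [MeasurableSpace M] (g : Metric n M) : Measure M :=
  ⨆ x₀ : M, chartVolume g x₀

/-- The vector field `u` in the coordinates of the chart around `x₀`, as a function of `z`. -/
def coordField (u : (x : M) → TangentSpace (𝓡 n) x) (x₀ : M) (z : EuclideanSpace ℝ (Fin n)) :
    EuclideanSpace ℝ (Fin n) :=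
  NormedSpace.fromTangentSpace _ (mfderiv (𝓡 n) 𝓘(ℝ, EuclideanSpace ℝ (Fin n))
    (extChartAt (𝓡 n) x₀) ((extChartAt (𝓡 n) x₀).symm z) (u ((extChartAt (𝓡 n) x₀).symm z)))

/-- The Riemannian divergence, `div u = (1 / √ det g) ∑ᵢ ∂ᵢ (√ det g uⁱ)` in coordinates; the value
at `x` is computed in the chart around `x`. -/
def divergence (g : Metric n M) (u : (x : M) → TangentSpace (𝓡 n) x) (x : M) : ℝ :=
  (chartDensity g x (extChartAt (𝓡 n) x x))⁻¹ *
    ∑ i : Fin n, fderiv ℝ (fun z => chartDensity g x z * coordField u x z i)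
      (extChartAt (𝓡 n) x x) (EuclideanSpace.single i (1 : ℝ))

/-- The right-invariant `Ḣ¹` metric on `Diff(M)`:
`⟨⟨u ∘ η, v ∘ η⟩⟩ = (1/4) ∫ div u · div v dμ`, independently of `η`. -/
def hDotInner [MeasurableSpace M] (g : Metric n M) (u v : (x : M) → TangentSpace (𝓡 n) x) : ℝ :=
  (1 / 4) * ∫ x, divergence g u x * divergence g v x ∂(riemVol g)

/-! ### Basic facts on the Jacobian -/

theorem volDensity_stdFrame_pos (g : Metric n M) (x : M) : 0 < volDensity g x (stdFrame x) := by
  unfold volDensity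
  apply Real.sqrt_pos.mpr
  apply Matrix.PosDef.det_pos
  refine Matrix.PosDef.of_dotProduct_mulVec_pos ?_ ?_
  · ext i j
    simp [Matrix.conjTranspose_apply, g.symm x (stdFrame x j)]
  · intro a ha
    have h : ∑ i, a i • stdFrame x i ≠ 0 := by
      intro h0
      apply ha
      funext j
      have h1 : ∑ i, a i • (EuclideanSpace.basisFun (Fin n) ℝ) i = 0 := by
        simp only [EuclideanSpace.basisFun_apply]
        exact h0
      exact (Fintype.linearIndependent_iff.mp
        (EuclideanSpace.basisFun (Fin n) ℝ).toBasis.linearIndependent) a (by simpa using h1) j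
    have h2 := g.pos x _ h
    rw [map_sum] at h2
    simp only [sum_apply, map_sum, map_smul, smul_apply,
      smul_eq_mul, Finset.mul_sum] at h2
    simp only [dotProduct, Matrix.mulVec, Matrix.of_apply, Finset.mul_sum, star_trivial]
    refine lt_of_lt_of_eq h2 ?_
    refine Finset.sum_congr rfl fun i _ => Finset.sum_congr rfl fun j _ => ?_
    rw [g.symm x (stdFrame x j) (stdFrame x i)]
    ring

/-- A linear map `L` multiplies the volume density of the standard frames by `|det L|`. -/
theorem volDensity_map (g : Metric n M) (y : M)
    (L : EuclideanSpace ℝ (Fin n) →ₗ[ℝ] EuclideanSpace ℝ (Fin n)) :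
    volDensity g y (fun i => (L (EuclideanSpace.single i (1 : ℝ)) : EuclideanSpace ℝ (Fin n))) =
      |LinearMap.det L| * volDensity g y (stdFrame y) := by
  let e := (EuclideanSpace.basisFun (Fin n) ℝ).toBasis
  let B : LinearMap.BilinForm ℝ (EuclideanSpace ℝ (Fin n)) :=
    LinearMap.mk₂ ℝ (fun v w : EuclideanSpace ℝ (Fin n) => g.inner y v w)
      (fun a b c => by rw [show g.inner y (a + b) = g.inner y a + g.inner y b from map_add _ _ _]; rfl)
      (fun a b c => by rw [show g.inner y (a • b) = a • g.inner y b from map_smul _ _ _]; rfl)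
      (fun a b c => map_add (g.inner y a) b c) (fun a b c => map_smul (g.inner y b) a c)
  have h1 : (Matrix.of fun i j : Fin n => g.inner y
      (L (EuclideanSpace.single i (1 : ℝ)) : EuclideanSpace ℝ (Fin n))
      (L (EuclideanSpace.single j (1 : ℝ)) : EuclideanSpace ℝ (Fin n))) =
      LinearMap.BilinForm.toMatrix e (B.comp L L) := by
    ext i j
    simp [e, LinearMap.BilinForm.toMatrix_apply, B]
  have h2 : (Matrix.of fun i j : Fin n => g.inner y (stdFrame y i) (stdFrame y j)) =
      LinearMap.BilinForm.toMatrix e B := by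
    ext i j
    simp [e, LinearMap.BilinForm.toMatrix_apply, B, stdFrame]
  unfold volDensity
  rw [h1, h2, LinearMap.BilinForm.toMatrix_comp e e, Matrix.det_mul, Matrix.det_mul,
    Matrix.det_transpose, LinearMap.det_toMatrix, mul_right_comm, ← pow_two,
    Real.sqrt_mul (sq_nonneg _), Real.sqrt_sq_eq_abs]

/-- The differential of a diffeomorphism in the standard frames. -/
def stdDeriv (η : Diff n M) (x : M) :
    EuclideanSpace ℝ (Fin n) →ₗ[ℝ] EuclideanSpace ℝ (Fin n) :=
  ContinuousLinearMap.toLinearMap (mfderiv (𝓡 n) (𝓡 n) η x)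

theorem jac_eq (g : Metric n M) (η : Diff n M) (x : M) :
    jac g η x = |LinearMap.det (stdDeriv η x)| * volDensity g (η x) (stdFrame (η x)) /
      volDensity g x (stdFrame x) := by
  rw [← volDensity_map]
  rfl

theorem jac_mul (g : Metric n M) (η ξ : Diff n M) (x : M) :
    jac g (η * ξ) x = jac g η (ξ x) * jac g ξ x := by
  have h : stdDeriv (η * ξ) x = stdDeriv η (ξ x) ∘ₗ stdDeriv ξ x := by
    have := mfderiv_comp x (η.mdifferentiable (by simp) (ξ x)) (ξ.mdifferentiable (by simp) x)
    unfold stdDeriv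
    exact congrArg ContinuousLinearMap.toLinearMap this
  have h0 := (volDensity_stdFrame_pos g (ξ x)).ne'
  rw [jac_eq, jac_eq, jac_eq, h, LinearMap.det_comp, abs_mul, Diff.mul_apply]
  field_simp

theorem jac_one (g : Metric n M) (x : M) : jac g 1 x = 1 := by
  have h : stdDeriv (1 : Diff n M) x = LinearMap.id := by
    unfold stdDeriv
    exact congrArg ContinuousLinearMap.toLinearMap (mfderiv_id (I := 𝓡 n) (x := x))
  rw [jac_eq, h, LinearMap.det_id, abs_one, one_mul, Diff.one_apply,
    div_self (volDensity_stdFrame_pos g x).ne']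

/-! ### The space of densities -/

/-- The subgroup `Diff_μ(M)` of volume-preserving diffeomorphisms, `η^* μ = μ`. -/
def diffVol (g : Metric n M) : Subgroup (Diff n M) where
  carrier := {η | ∀ x, jac g η x = 1}
  mul_mem' {η ξ} hη hξ x := by rw [jac_mul, hη, hξ, one_mul]
  one_mem' x := jac_one g x
  inv_mem' {η} hη x := by
    have h := jac_mul g η η⁻¹ x
    rwa [mul_inv_cancel, jac_one, hη, one_mul, eq_comm] at h

/-- The space of densities `Dens(M) = Diff(M) / Diff_μ(M)`, the space of right cosets
`Diff_μ(M) η`. -/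
abbrev Dens (g : Metric n M) : Type _ := Quotient (QuotientGroup.rightRel (diffVol g))

/-- The projection `Diff(M) → Dens(M)`. -/
def proj (g : Metric n M) (η : Diff n M) : Dens g := Quotient.mk _ η

/-- The density of a point of `Dens(M)` with respect to `μ`: the coset of `η` is the measure
`η^* μ = (Jac_μ η) μ`. -/
def density (g : Metric n M) (p : Dens g) : M → ℝ :=
  Quotient.lift (fun η : Diff n M => jac g η) (by
    intro η ζ h
    have h1 : ζ * η⁻¹ ∈ diffVol g := QuotientGroup.rightRel_apply.mp h
    funext x
    have h2 := jac_mul g (ζ * η⁻¹) η x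
    rw [inv_mul_cancel_right, h1, one_mul] at h2
    exact h2.symm) p

theorem density_proj (g : Metric n M) (η : Diff n M) : density g (proj g η) = jac g η := rfl

/-- Two points of `Dens(M)` with the same density are equal. -/
theorem density_injective (g : Metric n M) : Function.Injective (density g) := by
  intro p q
  refine Quotient.inductionOn₂ p q fun η ζ h => ?_
  apply Quotient.sound
  refine QuotientGroup.rightRel_apply.mpr fun x => ?_
  have h1 : jac g η (η⁻¹ x) = jac g ζ (η⁻¹ x) := congrFun h (η⁻¹ x)
  rw [jac_mul, ← h1, ← jac_mul, mul_inv_cancel, jac_one]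

/-- The vector `u ∘ η ∈ T_η Diff(M)` projects to the tangent vector `α` of `Dens(M)`; a tangent
vector of `Dens(M)` is written as the corresponding infinitesimal variation of the density. -/
def ProjectsTo (g : Metric n M) (η : Diff n M) (u : (x : M) → TangentSpace (𝓡 n) x)
    (α : M → ℝ) : Prop :=
  ∃ c : ℝ → Diff n M, IsCurveWithVelocity c η u ∧
    ∀ x, HasDerivAt (fun t => density g (proj g (c t)) x) (α x) 0

/-- `r` is the value on `α, β ∈ T_p Dens(M)` of the metric that the `Ḣ¹` metric induces on
the quotient: `r = ⟨⟨u ∘ η, v ∘ η⟩⟩` for some `η` over `p` and some lifts `u ∘ η`, `v ∘ η` of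
`α`, `β`. -/
def IsHDotValue [MeasurableSpace M] (g : Metric n M) (p : Dens g) (α β : M → ℝ) (r : ℝ) : Prop :=
  ∃ (η : Diff n M) (u v : (x : M) → TangentSpace (𝓡 n) x),
    proj g η = p ∧ IsSmoothField u ∧ IsSmoothField v ∧
      ProjectsTo g η u α ∧ ProjectsTo g η v β ∧ r = hDotInner g u v

open Classical in
/-- The `Ḣ¹` metric `⟨⟨α, β⟩⟩_p` on `Dens(M)` (zero when `α`, `β` are not tangent to `Dens(M)`). -/
def hDotMetric [MeasurableSpace M] (g : Metric n M) (p : Dens g) (α β : M → ℝ) : ℝ :=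
  if h : ∃ r, IsHDotValue g p α β r then h.choose else 0

/-! ### Statistical models -/

/-- A statistical model parameterized by `E`: a smooth family `ρ s`, `s ∈ E`, of positive densities
with respect to `μ`, with the total mass `μ(M)` (the probability densities, if `μ(M) = 1`). -/
structure IsStatisticalModel [MeasurableSpace M] (g : Metric n M) {k : ℕ}
    (E : Set (EuclideanSpace ℝ (Fin k))) (ρ : EuclideanSpace ℝ (Fin k) → M → ℝ) : Prop where
  smooth : ContMDiffOn (𝓘(ℝ, EuclideanSpace ℝ (Fin k)).prod (𝓡 n)) 𝓘(ℝ, ℝ) ∞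
    (fun q : EuclideanSpace ℝ (Fin k) × M => ρ q.1 q.2) (E ×ˢ univ)
  pos : ∀ s ∈ E, ∀ x, 0 < ρ s x
  mass : ∀ s ∈ E, ∫ x, ρ s x ∂(riemVol g) = (riemVol g).real univ

/-- The Fisher–Rao matrix `I_ij = ∫ (∂ log ρ / ∂ s_i) (∂ log ρ / ∂ s_j) ρ dμ`. -/
def fisherRao [MeasurableSpace M] (g : Metric n M) {k : ℕ}
    (ρ : EuclideanSpace ℝ (Fin k) → M → ℝ) (s : EuclideanSpace ℝ (Fin k)) (i j : Fin k) : ℝ :=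
  ∫ x, fderiv ℝ (fun s' => Real.log (ρ s' x)) s (EuclideanSpace.single i (1 : ℝ)) *
    fderiv ℝ (fun s' => Real.log (ρ s' x)) s (EuclideanSpace.single j (1 : ℝ)) * ρ s x ∂(riemVol g)

/-- The tangent vector of the family `ρ` at `s` in the direction `a`, as a variation of the
density. -/
def modelTangent {M : Type*} {k : ℕ} (ρ : EuclideanSpace ℝ (Fin k) → M → ℝ)
    (s a : EuclideanSpace ℝ (Fin k)) (x : M) : ℝ :=
  fderiv ℝ (fun s' => ρ s' x) s a

/-- A map `P : E → Dens(M)` is smooth for the quotient structure of `Dens(M) = Diff(M)/Diff_μ(M)`: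
near every point of `E` it is the projection of a smooth map to `Diff(M)`. -/
def IsSmoothInto (g : Metric n M) {k : ℕ} (E : Set (EuclideanSpace ℝ (Fin k)))
    (P : EuclideanSpace ℝ (Fin k) → Dens g) : Prop :=
  ∀ s₀ ∈ E, ∃ U : Set (EuclideanSpace ℝ (Fin k)), IsOpen U ∧ s₀ ∈ U ∧ U ⊆ E ∧
    ∃ η : EuclideanSpace ℝ (Fin k) → Diff n M, SmoothFamilyOn η U ∧ ∀ s ∈ U, proj g (η s) = P s

end Riemannian

end DensityGeometry

end

/-! Both metrics are the quadratic form `∫ α β / ρ dμ` on variations of the density, up to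
constants. If `u ∘ η` lifts `α` at `η`, the first variation of the Jacobian gives `α = (div u ∘ η) ·
Jac η` (`ProjectsTo.eq_divergence_mul_jac`). Substituting `x ↦ η x` in `∫ div u · div v dμ`
(`integral_comp_mul_jac`) therefore turns it into `∫ α β / ρ dμ` with `ρ = Jac η`
(`IsHDotValue.eq_integral`). No choice of `η`, `u` or `v` survives in this expression, so the metric
descends. On the other side `∂ log ρ = ∂ρ / ρ`, so the Fisher–Rao form is the same integral without
the factor 1/4 (`IsStatisticalModel.sum_fisherRao`).

Two facts carry the work. The first variation is computed in a chart by
`hasDerivAt_density_mul_det`, from Jacobi's formula for the derivative of a determinant and the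
symmetry of second derivatives; right translation, under which the Jacobian is a cocycle, moves the
result from the identity to any `η`. The change of variables is the Euclidean one in each pair of
charts, glued over a finite cover; it also shows that the chart measures agree on overlaps, so the
supremum `riemVol` really is each of them locally.

For a smooth map into `Dens(M)`, lifts of the tangent vectors are the velocities of a local lift to
`Diff(M)`. -/

noncomputable section

namespace DensityGeometry

/-! ### Euclidean calculus: derivative of the determinant and of a transported density -/

section Calculus

variable {n : ℕ}

local notation "𝔼" => EuclideanSpace ℝ (Fin n)

/-- The matrix of a continuous linear map in the standard basis. -/
def stdMatrix (A : 𝔼 →L[ℝ] 𝔼) : Matrix (Fin n) (Fin n) ℝ :=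
  Matrix.of fun i j => A (EuclideanSpace.single j 1) i

theorem det_stdMatrix (A : 𝔼 →L[ℝ] 𝔼) : (stdMatrix A).det = A.det := by
  rw [ContinuousLinearMap.det, ← LinearMap.det_toMatrix (EuclideanSpace.basisFun (Fin n) ℝ).toBasis]
  exact congrArg Matrix.det (by ext i j; simp [stdMatrix, LinearMap.toMatrix_apply])

theorem contDiff_det {m : WithTop ℕ∞} : ContDiff ℝ m (fun A : 𝔼 →L[ℝ] 𝔼 => A.det) := by
  simp_rw [← det_stdMatrix, Matrix.det_apply]
  refine ContDiff.sum fun σ _ => ContDiff.const_smul _ ?_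
  refine contDiff_prod fun i _ => ?_
  simp only [stdMatrix, Matrix.of_apply]
  fun_prop

/-- Jacobi's formula at the identity, read off from the linear coefficient of the polynomial `det (1
+ t B)`. -/
theorem fderiv_det_id (B : 𝔼 →L[ℝ] 𝔼) :
    fderiv ℝ (fun A : 𝔼 →L[ℝ] 𝔼 => A.det) (ContinuousLinearMap.id ℝ 𝔼) B =
      ∑ i, B (EuclideanSpace.single i 1) i := by
  have h1 : HasDerivAt (fun t : ℝ => ContinuousLinearMap.id ℝ 𝔼 + t • B) B 0 := by
    simpa using ((hasDerivAt_id (0 : ℝ)).smul_const B).const_add (ContinuousLinearMap.id ℝ 𝔼)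
  have hd : DifferentiableAt ℝ (fun A : 𝔼 →L[ℝ] 𝔼 => A.det)
      (ContinuousLinearMap.id ℝ 𝔼 + (0 : ℝ) • B) :=
    (contDiff_det (m := 1)).differentiable one_ne_zero _
  have h2 := hd.hasFDerivAt.comp_hasDerivAt (0 : ℝ) h1
  have h0 : ContinuousLinearMap.id ℝ 𝔼 + (0 : ℝ) • B = ContinuousLinearMap.id ℝ 𝔼 := by
    ext; simp
  rw [h0] at h2
  refine h2.unique ?_
  -- Dividing the polynomial twice by `X` leaves the remainder after the constant and linear terms;
  -- its factor `t ^ 2` makes it irrelevant at `t = 0`.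
  have h3 : ∀ t : ℝ, (ContinuousLinearMap.id ℝ 𝔼 + t • B).det =
      1 + (stdMatrix B).trace * t +
        ((1 + (Polynomial.X : Polynomial ℝ) • (stdMatrix B).map Polynomial.C).det.divX.divX).eval t *
          t ^ 2 := by
    intro t
    rw [← Matrix.det_one_add_smul, ← det_stdMatrix]
    congr 1
    ext i j
    simp [stdMatrix, Matrix.one_apply]
  have h4 : (fun A : 𝔼 →L[ℝ] 𝔼 => A.det) ∘ (fun t : ℝ => ContinuousLinearMap.id ℝ 𝔼 + t • B) = 
      fun t : ℝ => 1 + (stdMatrix B).trace * t +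
        ((1 + (Polynomial.X : Polynomial ℝ) • (stdMatrix B).map Polynomial.C).det.divX.divX).eval t *
          t ^ 2 := funext h3
  rw [h4]
  have h5 := (((hasDerivAt_id (0 : ℝ)).const_mul (stdMatrix B).trace).const_add 1).add
    ((((1 + (Polynomial.X : Polynomial ℝ) •
      (stdMatrix B).map Polynomial.C).det.divX.divX).hasDerivAt (0 : ℝ)).mul
      (hasDerivAt_pow 2 (0 : ℝ)))
  refine (HasDerivAt.congr_deriv h5 ?_ :)
  simp [Matrix.trace, stdMatrix]

theorem fderiv_partial_right {F G H : Type*} [NormedAddCommGroup F] [NormedSpace ℝ F]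
    [NormedAddCommGroup G] [NormedSpace ℝ G] [NormedAddCommGroup H] [NormedSpace ℝ H]
    {f : F × G → H} {s : F} {z : G} (hf : DifferentiableAt ℝ f (s, z)) :
    fderiv ℝ (fun z' => f (s, z')) z = (fderiv ℝ f (s, z)).comp (ContinuousLinearMap.inr ℝ F G) :=
  (hf.hasFDerivAt.comp z (hasFDerivAt_prodMk_right s z)).fderiv

theorem fderiv_partial_left {F G H : Type*} [NormedAddCommGroup F] [NormedSpace ℝ F]
    [NormedAddCommGroup G] [NormedSpace ℝ G] [NormedAddCommGroup H] [NormedSpace ℝ H]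
    {f : F × G → H} {s : F} {z : G} (hf : DifferentiableAt ℝ f (s, z)) :
    fderiv ℝ (fun s' => f (s', z)) s = (fderiv ℝ f (s, z)).comp (ContinuousLinearMap.inl ℝ F G) :=
  (hf.hasFDerivAt.comp s (hasFDerivAt_prodMk_left s z)).fderiv

/-- The change of volume along a flow of local diffeomorphisms with velocity `w`. -/
theorem hasDerivAt_density_mul_det {Φ : ℝ × 𝔼 → 𝔼} {z : 𝔼} {w : 𝔼 → 𝔼} {D : 𝔼 → ℝ}
    (hΦ : ContDiffAt ℝ 2 Φ (0, z)) (hid : ∀ᶠ y in 𝓝 z, Φ (0, y) = y)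
    (hw : ∀ᶠ y in 𝓝 z, HasDerivAt (fun t => Φ (t, y)) (w y) 0) (hD : DifferentiableAt ℝ D z) :
    HasDerivAt (fun t => D (Φ (t, z)) * |(fderiv ℝ (fun y => Φ (t, y)) z).det|)
      (∑ i : Fin n, fderiv ℝ (fun y => D y * w y i) z (EuclideanSpace.single i 1)) 0 := by
  have hdiff : ∀ᶠ p in 𝓝 ((0 : ℝ), z), DifferentiableAt ℝ Φ p :=
    (hΦ.eventually (by simp)).mono fun p hp => hp.differentiableAt two_ne_zero
  have hz : Filter.Tendsto (fun y : 𝔼 => ((0 : ℝ), y)) (𝓝 z) (𝓝 (0, z)) :=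
    (Continuous.prodMk_right (0 : ℝ)).tendsto z
  have ht : Filter.Tendsto (fun t : ℝ => (t, z)) (𝓝 0) (𝓝 (0, z)) :=
    (Continuous.prodMk_left z).tendsto 0
  have hΦ' : ContDiffAt ℝ 1 (fderiv ℝ Φ) (0, z) := hΦ.fderiv_right (by norm_num)
  have hdΦ' := (hΦ'.differentiableAt one_ne_zero).hasFDerivAt
  -- the velocity field in terms of the derivative of the flow
  have hw' : w =ᶠ[𝓝 z] fun y => fderiv ℝ Φ (0, y) (1, 0) := by
    filter_upwards [hw, hz.eventually hdiff] with y h1 h2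
    have h3 := h2.hasFDerivAt.comp_hasDerivAt (0 : ℝ)
      ((hasDerivAt_id (0 : ℝ)).prodMk (hasDerivAt_const (0 : ℝ) y))
    exact h1.unique h3
  have hwd : HasFDerivAt w (((ContinuousLinearMap.apply ℝ 𝔼 ((1 : ℝ), (0 : 𝔼))).comp
      (fderiv ℝ (fderiv ℝ Φ) (0, z))).comp (ContinuousLinearMap.inr ℝ ℝ 𝔼)) z := by
    refine HasFDerivAt.congr_of_eventuallyEq ?_ hw'
    exact ((ContinuousLinearMap.apply ℝ 𝔼 ((1 : ℝ), (0 : 𝔼))).hasFDerivAt.comp _ hdΦ').comp z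
      (hasFDerivAt_prodMk_right (0 : ℝ) z)
  have hA0 : fderiv ℝ (fun y => Φ (0, y)) z = ContinuousLinearMap.id ℝ 𝔼 := by
    have : (fun y => Φ (0, y)) =ᶠ[𝓝 z] id := hid
    rw [this.fderiv_eq, fderiv_id]
  have hA : HasDerivAt (fun t => fderiv ℝ (fun y => Φ (t, y)) z)
      ((fderiv ℝ (fderiv ℝ Φ) (0, z) (1, 0)).comp (ContinuousLinearMap.inr ℝ ℝ 𝔼)) 0 := by
    have h1 : (fun t => fderiv ℝ (fun y => Φ (t, y)) z) =ᶠ[𝓝 0]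
        fun t => (fderiv ℝ Φ (t, z)).comp (ContinuousLinearMap.inr ℝ ℝ 𝔼) := by
      filter_upwards [ht.eventually hdiff] with t h using fderiv_partial_right h
    refine HasDerivAt.congr_of_eventuallyEq ?_ h1
    have h2 : HasDerivAt (fun t : ℝ => fderiv ℝ Φ (t, z))
        (fderiv ℝ (fderiv ℝ Φ) (0, z) (1, 0)) 0 :=
      hdΦ'.comp_hasDerivAt (0 : ℝ) ((hasDerivAt_id (0 : ℝ)).prodMk (hasDerivAt_const (0 : ℝ) z))
    exact (((ContinuousLinearMap.compL ℝ 𝔼 (ℝ × 𝔼) 𝔼).flip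
      (ContinuousLinearMap.inr ℝ ℝ 𝔼)).hasFDerivAt.comp_hasDerivAt (0 : ℝ) h2)
  have hdet : HasDerivAt (fun t => (fderiv ℝ (fun y => Φ (t, y)) z).det)
      (∑ i, fderiv ℝ (fderiv ℝ Φ) (0, z) (1, 0) (0, EuclideanSpace.single i 1) i) 0 := by
    have h1 : DifferentiableAt ℝ (fun A : 𝔼 →L[ℝ] 𝔼 => A.det)
        (fderiv ℝ (fun y => Φ (0, y)) z) := (contDiff_det (m := 1)).differentiable one_ne_zero _
    have h2 := h1.hasFDerivAt.comp_hasDerivAt (0 : ℝ) hA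
    rw [hA0, fderiv_det_id] at h2
    exact h2
  have hdet0 : (fderiv ℝ (fun y => Φ (0, y)) z).det = 1 := by
    rw [hA0]; simp [ContinuousLinearMap.det]
  have habs : HasDerivAt (fun t => |(fderiv ℝ (fun y => Φ (t, y)) z).det|)
      (∑ i, fderiv ℝ (fderiv ℝ Φ) (0, z) (1, 0) (0, EuclideanSpace.single i 1) i) 0 := by
    -- The determinant is 1 at `t = 0`, hence positive nearby, and the absolute value can be
    -- dropped.
    refine hdet.congr_of_eventuallyEq ?_
    have : ∀ᶠ t in 𝓝 (0 : ℝ), 0 < (fderiv ℝ (fun y => Φ (t, y)) z).det :=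
      hdet.continuousAt.eventually (lt_mem_nhds (lt_of_lt_of_eq one_pos hdet0.symm))
    filter_upwards [this] with t h using abs_of_pos h
  have hDt : HasDerivAt (fun t => D (Φ (t, z))) (fderiv ℝ D z (w z)) 0 := by
    have h1 : DifferentiableAt ℝ D (Φ (0, z)) := by rw [hid.self_of_nhds]; exact hD
    have h2 := h1.hasFDerivAt.comp_hasDerivAt (0 : ℝ) hw.self_of_nhds
    rw [hid.self_of_nhds] at h2
    exact h2
  have hprod := hDt.mul habs
  rw [hdet0, hid.self_of_nhds, abs_one, mul_one] at hprod
  refine hprod.congr_deriv ?_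
  -- Schwarz: the time derivative of the space differential of the flow is the space derivative of
  -- its velocity. Thus the trace produced by `hdet` is the sum of the `∂ᵢ wⁱ`, and the product rule
  -- gives the claim.
  have hsymm : IsSymmSndFDerivAt ℝ Φ (0, z) := hΦ.isSymmSndFDerivAt (by simp)
  have hwi : ∀ i, HasFDerivAt (fun y => w y i) ((EuclideanSpace.proj i : 𝔼 →L[ℝ] ℝ).comp
      (((ContinuousLinearMap.apply ℝ 𝔼 ((1 : ℝ), (0 : 𝔼))).comp
      (fderiv ℝ (fderiv ℝ Φ) (0, z))).comp (ContinuousLinearMap.inr ℝ ℝ 𝔼))) z := fun i =>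
    (EuclideanSpace.proj i : 𝔼 →L[ℝ] ℝ).hasFDerivAt.comp z hwd
  have hterm : ∀ i, fderiv ℝ (fun y => D y * w y i) z (EuclideanSpace.single i 1) =
      w z i * fderiv ℝ D z (EuclideanSpace.single i 1) +
        D z * fderiv ℝ (fderiv ℝ Φ) (0, z) (1, 0) (0, EuclideanSpace.single i 1) i := by
    intro i
    have hp : HasFDerivAt (fun y => D y * w y i) _ z := hD.hasFDerivAt.mul (hwi i)
    rw [hp.fderiv]
    have := hsymm.eq (0, EuclideanSpace.single i 1) (1, 0)
    simp [← this]
    ring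
  rw [Finset.sum_congr rfl fun i _ => hterm i, Finset.sum_add_distrib, Finset.mul_sum]
  congr 1
  have hsum : w z = ∑ i, w z i • EuclideanSpace.single i (1 : ℝ) := by
    ext j
    simp [Finset.sum_apply, Pi.single_apply]
  conv_lhs => rw [hsum]
  simp

end Calculus

/-! ### The volume density and the Jacobian in charts -/

section Charts

variable {n : ℕ} {M : Type*} [TopologicalSpace M] [ChartedSpace (EuclideanSpace ℝ (Fin n)) M]

local notation "𝔼" => EuclideanSpace ℝ (Fin n)

theorem extChartAt_target_mem_nhds_of_mem {x₀ : M} {z : 𝔼} (hz : z ∈ (extChartAt (𝓡 n) x₀).target) :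
    (extChartAt (𝓡 n) x₀).target ∈ 𝓝 z :=
  (isOpen_extChartAt_target x₀).mem_nhds hz

variable [IsManifold (𝓡 n) ∞ M]

theorem contMDiffAt_chart {x₀ x : M} (hx : x ∈ (extChartAt (𝓡 n) x₀).source) :
    ContMDiffAt (𝓡 n) 𝓘(ℝ, 𝔼) ∞ (extChartAt (𝓡 n) x₀) x :=
  contMDiffAt_extChartAt' (by simpa using hx)

theorem contMDiffAt_chart_symm {x₀ : M} {z : 𝔼} (hz : z ∈ (extChartAt (𝓡 n) x₀).target) :
    ContMDiffAt 𝓘(ℝ, 𝔼) (𝓡 n) ∞ (extChartAt (𝓡 n) x₀).symm z :=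
  (contMDiffOn_extChartAt_symm x₀).contMDiffAt (extChartAt_target_mem_nhds_of_mem hz)

/-- The differential of the inverse of the chart around `x₀`, in the standard frames. -/
def chartSymmDeriv (x₀ : M) (z : 𝔼) : 𝔼 →ₗ[ℝ] 𝔼 :=
  ContinuousLinearMap.toLinearMap (mfderiv (𝓡 n) (𝓡 n) (extChartAt (𝓡 n) x₀).symm z)

/-- Isolates the dependence on the chart in a determinant, so that comparisons between charts reduce
to multiplicativity of `det`. -/
theorem chartDensity_eq (g : Metric n M) (x₀ : M) (z : 𝔼) :
    chartDensity g x₀ z = |LinearMap.det (chartSymmDeriv x₀ z)| *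
      volDensity g ((extChartAt (𝓡 n) x₀).symm z) (stdFrame ((extChartAt (𝓡 n) x₀).symm z)) := by
  rw [← volDensity_map]
  rfl

theorem det_chartSymmDeriv_ne_zero {x₀ : M} {z : 𝔼} (hz : z ∈ (extChartAt (𝓡 n) x₀).target) :
    LinearMap.det (chartSymmDeriv x₀ z) ≠ 0 := by
  have : IsManifold (𝓡 n) 1 M := IsManifold.of_le (n := ∞) (by simp)
  have h := mfderiv_extChartAt_comp_mfderivWithin_extChartAt_symm (I := 𝓡 n) hz
  have hr : range (𝓡 n) = univ := by simp
  rw [hr, mfderivWithin_univ] at h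
  have h2 : (ContinuousLinearMap.toLinearMap (mfderiv (𝓡 n) 𝓘(ℝ, 𝔼) (extChartAt (𝓡 n) x₀)
      ((extChartAt (𝓡 n) x₀).symm z)) : 𝔼 →ₗ[ℝ] 𝔼) ∘ₗ chartSymmDeriv x₀ z = LinearMap.id :=
    congrArg ContinuousLinearMap.toLinearMap h
  intro h0
  have h3 := congrArg LinearMap.det h2
  rw [LinearMap.det_comp, h0, mul_zero, LinearMap.det_id] at h3
  exact zero_ne_one h3

theorem chartDensity_pos (g : Metric n M) {x₀ : M} {z : 𝔼}
    (hz : z ∈ (extChartAt (𝓡 n) x₀).target) : 0 < chartDensity g x₀ z := by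
  rw [chartDensity_eq]
  exact mul_pos (abs_pos.mpr (det_chartSymmDeriv_ne_zero hz)) (volDensity_stdFrame_pos g _)

/-- The tangent map of the inverse chart is smooth, and the coordinate field is its composition with
the constant field `v`. -/
theorem contMDiffAt_chartFrame {x₀ : M} {z : 𝔼} (hz : z ∈ (extChartAt (𝓡 n) x₀).target)
    (v : 𝔼) :
    ContMDiffAt 𝓘(ℝ, 𝔼) (𝓡 n).tangent ∞ (fun z' => (⟨(extChartAt (𝓡 n) x₀).symm z',
      mfderiv (𝓡 n) (𝓡 n) (extChartAt (𝓡 n) x₀).symm z' v⟩ : TangentBundle (𝓡 n) M)) z := by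
  have : IsManifold (𝓡 n) 1 M := IsManifold.of_le (n := ∞) (by simp)
  have hopen := isOpen_extChartAt_target (I := 𝓡 n) x₀
  have h := (contMDiffOn_extChartAt_symm (I := 𝓡 n) (n := ∞) x₀).contMDiffOn_tangentMapWithin
    (m := ∞) (by simp) hopen.uniqueMDiffOn
  have h1 : ContMDiff 𝓘(ℝ, 𝔼) 𝓘(ℝ, 𝔼).tangent ∞
      (fun z' : 𝔼 => (⟨z', v⟩ : TangentBundle 𝓘(ℝ, 𝔼) 𝔼)) := by
    exact contMDiff_vectorSpace_iff_contDiff.mpr contDiff_const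
  have h2 := h.comp h1.contMDiffOn (s := (extChartAt (𝓡 n) x₀).target) (fun z' hz' => hz')
  refine (h2.contMDiffAt (hopen.mem_nhds hz)).congr_of_eventuallyEq ?_
  filter_upwards [hopen.mem_nhds hz] with z' hz'
  simp only [Function.comp, tangentMapWithin]
  rw [mfderivWithin_of_isOpen hopen hz']

/-- The Gram determinant is a polynomial in smooth entries, and its square root is smooth because it
does not vanish. -/
theorem contDiffAt_chartDensity (g : Metric n M) {x₀ : M} {z : 𝔼}
    (hz : z ∈ (extChartAt (𝓡 n) x₀).target) : ContDiffAt ℝ ∞ (chartDensity g x₀) z := by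
  have hentry : ∀ i j : Fin n, ContDiffAt ℝ ∞ (fun z' => g.inner ((extChartAt (𝓡 n) x₀).symm z')
      (mfderiv (𝓡 n) (𝓡 n) (extChartAt (𝓡 n) x₀).symm z' (stdFrame z' i))
      (mfderiv (𝓡 n) (𝓡 n) (extChartAt (𝓡 n) x₀).symm z' (stdFrame z' j))) z := by
    intro i j
    rw [← contMDiffAt_iff_contDiffAt]
    have hg := (g.contMDiff ((extChartAt (𝓡 n) x₀).symm z)).comp z (contMDiffAt_chart_symm hz)
    have h := ContMDiffAt.clm_bundle_apply₂ (F₁ := 𝔼) (F₂ := 𝔼) (F₃ := ℝ)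
      (E₁ := fun x : M => TangentSpace (𝓡 n) x) (E₂ := fun x : M => TangentSpace (𝓡 n) x)
      (E₃ := Bundle.Trivial M ℝ) hg
      (contMDiffAt_chartFrame hz (EuclideanSpace.single i 1))
      (contMDiffAt_chartFrame hz (EuclideanSpace.single j 1))
    exact (Bundle.contMDiffAt_totalSpace.mp h).2
  have hdet : ContDiffAt ℝ ∞ (fun z' => Matrix.det (Matrix.of fun i j =>
      g.inner ((extChartAt (𝓡 n) x₀).symm z')
      (mfderiv (𝓡 n) (𝓡 n) (extChartAt (𝓡 n) x₀).symm z' (stdFrame z' i))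
      (mfderiv (𝓡 n) (𝓡 n) (extChartAt (𝓡 n) x₀).symm z' (stdFrame z' j)))) z := by
    simp_rw [Matrix.det_apply]
    refine ContDiffAt.sum fun σ _ => ContDiffAt.const_smul _ ?_
    exact contDiffAt_prod fun i _ => hentry _ _
  exact hdet.sqrt (Real.sqrt_pos.mp (chartDensity_pos g hz)).ne'

/-- The Jacobian in a pair of charts. -/
theorem jac_mul_chartDensity (g : Metric n M) (η : Diff n M) {x₀ x₁ x : M}
    (hx : x ∈ (extChartAt (𝓡 n) x₀).source) (hy : η x ∈ (extChartAt (𝓡 n) x₁).source) :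
    jac g η x * chartDensity g x₀ (extChartAt (𝓡 n) x₀ x) =
      chartDensity g x₁ (extChartAt (𝓡 n) x₁ (η x)) *
        |(fderiv ℝ (fun z => extChartAt (𝓡 n) x₁ (η ((extChartAt (𝓡 n) x₀).symm z)))
          (extChartAt (𝓡 n) x₀ x)).det| := by
  set z := extChartAt (𝓡 n) x₀ x with hz
  have hxz : (extChartAt (𝓡 n) x₀).symm z = x := (extChartAt (𝓡 n) x₀).left_inv hx
  have hyz : (extChartAt (𝓡 n) x₁).symm (extChartAt (𝓡 n) x₁ (η x)) = η x :=
    (extChartAt (𝓡 n) x₁).left_inv hy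
  have hzt : z ∈ (extChartAt (𝓡 n) x₀).target := (extChartAt (𝓡 n) x₀).map_source hx
  have hwt := (extChartAt (𝓡 n) x₁).map_source hy
  have hφ : MDifferentiableAt 𝓘(ℝ, 𝔼) (𝓡 n) (extChartAt (𝓡 n) x₀).symm z :=
    (contMDiffAt_chart_symm hzt).mdifferentiableAt (by simp)
  have hψ : MDifferentiableAt 𝓘(ℝ, 𝔼) (𝓡 n) (extChartAt (𝓡 n) x₁).symm
      (extChartAt (𝓡 n) x₁ (η x)) := (contMDiffAt_chart_symm hwt).mdifferentiableAt (by simp)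
  have hηφ : MDifferentiableAt 𝓘(ℝ, 𝔼) (𝓡 n) (fun z' => η ((extChartAt (𝓡 n) x₀).symm z')) z :=
    (η.mdifferentiable (by simp) _).comp z hφ
  have hG : MDifferentiableAt 𝓘(ℝ, 𝔼) 𝓘(ℝ, 𝔼)
      (fun z' => extChartAt (𝓡 n) x₁ (η ((extChartAt (𝓡 n) x₀).symm z'))) z := by
    refine MDifferentiableAt.comp z (I' := 𝓡 n) ?_ hηφ
    rw [hxz]
    exact (contMDiffAt_chart hy).mdifferentiableAt (by simp)
  have hGz : (fun z' => extChartAt (𝓡 n) x₁ (η ((extChartAt (𝓡 n) x₀).symm z'))) z =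
      extChartAt (𝓡 n) x₁ (η x) := by simp only [hxz]
  -- The factorization of `η` through the second chart holds only near `z`, which suffices for the
  -- differentials. The chain rule on both sides gives `hd`, whose determinants are the assertion.
  have hcomp : (fun z' => η ((extChartAt (𝓡 n) x₀).symm z')) =ᶠ[𝓝 z]
      (extChartAt (𝓡 n) x₁).symm ∘
        (fun z' => extChartAt (𝓡 n) x₁ (η ((extChartAt (𝓡 n) x₀).symm z'))) := by
    have h1 : ∀ᶠ z' in 𝓝 z, η ((extChartAt (𝓡 n) x₀).symm z') ∈ (extChartAt (𝓡 n) x₁).source :=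
      hηφ.continuousAt.eventually
        ((isOpen_extChartAt_source x₁).mem_nhds (by simpa only [hxz] using hy))
    filter_upwards [h1] with z' h using ((extChartAt (𝓡 n) x₁).left_inv h).symm
  have hd : stdDeriv η x ∘ₗ chartSymmDeriv x₀ z = chartSymmDeriv x₁ (extChartAt (𝓡 n) x₁ (η x)) ∘ₗ
      (fderiv ℝ (fun z' => extChartAt (𝓡 n) x₁ (η ((extChartAt (𝓡 n) x₀).symm z')))
        z).toLinearMap := by
    have h1 := mfderiv_comp z (η.mdifferentiable (by simp) ((extChartAt (𝓡 n) x₀).symm z)) hφ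
    have h2 := mfderiv_comp_of_eq (x := z) hψ hG hGz
    have h3 := hcomp.mfderiv_eq (I := 𝓘(ℝ, 𝔼)) (I' := 𝓡 n)
    rw [mfderiv_eq_fderiv] at h2
    have h4 := h1.symm.trans (h3.trans h2)
    have h5 : stdDeriv η ((extChartAt (𝓡 n) x₀).symm z) ∘ₗ chartSymmDeriv x₀ z = _ :=
      congrArg ContinuousLinearMap.toLinearMap h4
    rw [hxz] at h5
    exact h5
  have hdet := congrArg (fun L => |LinearMap.det L|) hd
  simp only [LinearMap.det_comp, abs_mul] at hdet
  have h0 := (volDensity_stdFrame_pos g x).ne'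
  rw [jac_eq, chartDensity_eq, chartDensity_eq, hxz, hyz, ContinuousLinearMap.det]
  field_simp
  linear_combination volDensity g (η x) (stdFrame (η x)) * hdet

end Charts

/-! ### Smooth families of diffeomorphisms and the first variation of the Jacobian -/

section Families

variable {n : ℕ} {M : Type*} [TopologicalSpace M] [ChartedSpace (EuclideanSpace ℝ (Fin n)) M]
  {F : Type*} [NormedAddCommGroup F] [NormedSpace ℝ F]

local notation "𝔼" => EuclideanSpace ℝ (Fin n)

theorem SmoothFamilyOn.contMDiffAt {η : F → Diff n M} {U : Set F} (hη : SmoothFamilyOn η U)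
    (hU : IsOpen U) {s : F} (hs : s ∈ U) (x : M) :
    ContMDiffAt (𝓘(ℝ, F).prod (𝓡 n)) (𝓡 n) ∞ (fun q : F × M => η q.1 q.2) (s, x) :=
  ContMDiffOn.contMDiffAt hη ((hU.prod isOpen_univ).mem_nhds ⟨hs, mem_univ x⟩)

/-- Identifies the product of two model spaces with the product vector space, to pass between
manifold smoothness and ordinary calculus. -/
theorem contMDiffAt_prod_self_iff {G H : Type*} [NormedAddCommGroup G] [NormedSpace ℝ G]
    [NormedAddCommGroup H] [NormedSpace ℝ H] {f : F × G → H} {p : F × G} :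
    ContMDiffAt (𝓘(ℝ, F).prod 𝓘(ℝ, G)) 𝓘(ℝ, H) ∞ f p ↔ ContDiffAt ℝ ∞ f p := by
  rw [← contMDiffAt_iff_contDiffAt, modelWithCornersSelf_prod, ← chartedSpaceSelf_prod]

/-- The velocity field at `s` in the direction `a` of a family of diffeomorphisms, in Eulerian
coordinates. -/
def familyVelocity (η : F → Diff n M) (s a : F) (x : M) : TangentSpace (𝓡 n) x :=
  (mfderiv (𝓘(ℝ, F).prod (𝓡 n)) (𝓡 n) (fun q : F × M => η q.1 q.2) (s, (η s)⁻¹ x)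
    ((a, 0) : F × 𝔼) : 𝔼)

theorem SmoothFamilyOn.isCurveWithVelocity {η : F → Diff n M} {U : Set F}
    (hη : SmoothFamilyOn η U) (hU : IsOpen U) {s : F} (hs : s ∈ U) (a : F) :
    IsCurveWithVelocity (fun t : ℝ => η (s + t • a)) (η s) (familyVelocity η s a) := by
  have hline : ContDiff ℝ ∞ (fun t : ℝ => s + t • a) := by fun_prop
  refine ⟨⟨(fun t : ℝ => s + t • a) ⁻¹' U, hU.preimage hline.continuous, by simpa using hs, ?_⟩,
    by simp, fun x => ?_⟩
  · have h1 : ContMDiff (𝓘(ℝ, ℝ).prod (𝓡 n)) (𝓘(ℝ, F).prod (𝓡 n)) ∞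
        (Prod.map (fun t : ℝ => s + t • a) (id : M → M)) :=
      hline.contMDiff.prodMap contMDiff_id
    exact ContMDiffOn.comp hη h1.contMDiffOn fun q hq => ⟨hq.1, mem_univ _⟩
  · have h1 := ((hη.contMDiffAt hU hs x).mdifferentiableAt (by simp)).hasMFDerivAt
    have h2 : HasDerivAt (fun t : ℝ => s + t • a) a 0 := by
      simpa using ((hasDerivAt_id (0 : ℝ)).smul_const a).const_add s
    have h3 : HasMFDerivAt 𝓘(ℝ, ℝ) (𝓘(ℝ, F).prod (𝓡 n)) (fun t : ℝ => (s + t • a, x)) 0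
        ((ContinuousLinearMap.toSpanSingleton ℝ a).prod (0 : ℝ →L[ℝ] 𝔼)) :=
      (hasMFDerivAt_iff_hasFDerivAt.mpr h2.hasFDerivAt).prodMk (hasMFDerivAt_const x (0 : ℝ))
    have h0 : ((s, x) : F × M) = (s + (0 : ℝ) • a, x) := by simp
    rw [h0] at h1
    have h4 := h1.comp (0 : ℝ) h3
    refine h4.congr_mfderiv ?_
    -- The tangent spaces at equal base points are different types until the equality is eliminated,
    -- so the values are compared in `𝔼`.
    have key : ∀ q q' : F × M, q = q' →
        (mfderiv (𝓘(ℝ, F).prod (𝓡 n)) (𝓡 n) (fun q : F × M => η q.1 q.2) q ((a, 0) : F × 𝔼) : 𝔼) =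
        mfderiv (𝓘(ℝ, F).prod (𝓡 n)) (𝓡 n) (fun q : F × M => η q.1 q.2) q' ((a, 0) : F × 𝔼) := by
      rintro q _ rfl
      rfl
    have h5 : ((s + (0 : ℝ) • a, x) : F × M) = (s, (η s)⁻¹ (η (s + (0 : ℝ) • a) x)) := by
      rw [zero_smul, add_zero, ← Diff.mul_apply, inv_mul_cancel, Diff.one_apply]
    have h6 : (((1 : ℝ) • a, 0) : F × 𝔼) = (a, 0) := by rw [one_smul]
    refine ContinuousLinearMap.ext_ring ?_
    refine Eq.trans ?_ (one_smul ℝ (familyVelocity η s a (η (s + (0 : ℝ) • a) x))).symm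
    exact (congrArg _ h6).trans (key _ _ h5)

variable [IsManifold (𝓡 n) ∞ M]

/-- A smooth family of diffeomorphisms read in a pair of charts. -/
def chartFamily (η : F → Diff n M) (x₀ x₁ : M) (p : F × 𝔼) : 𝔼 :=
  extChartAt (𝓡 n) x₁ (η p.1 ((extChartAt (𝓡 n) x₀).symm p.2))

theorem SmoothFamilyOn.contDiffAt_chartFamily {η : F → Diff n M} {U : Set F}
    (hη : SmoothFamilyOn η U) (hU : IsOpen U) {s : F} (hs : s ∈ U) {x₀ x₁ x : M}
    (hx : x ∈ (extChartAt (𝓡 n) x₀).source) (hy : η s x ∈ (extChartAt (𝓡 n) x₁).source) :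
    ContDiffAt ℝ ∞ (chartFamily η x₀ x₁) (s, extChartAt (𝓡 n) x₀ x) := by
  have hxz := (extChartAt (𝓡 n) x₀).left_inv hx
  refine contMDiffAt_prod_self_iff.mp ?_
  have h1 : ContMDiffAt (𝓘(ℝ, F).prod 𝓘(ℝ, 𝔼)) (𝓘(ℝ, F).prod (𝓡 n)) ∞
      (Prod.map id (extChartAt (𝓡 n) x₀).symm) (s, extChartAt (𝓡 n) x₀ x) :=
    contMDiffAt_id.prodMap (contMDiffAt_chart_symm ((extChartAt (𝓡 n) x₀).map_source hx))
  have h2 : ContMDiffAt (𝓘(ℝ, F).prod (𝓡 n)) 𝓘(ℝ, 𝔼) ∞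
      (fun q : F × M => extChartAt (𝓡 n) x₁ (η q.1 q.2)) (s, x) :=
    ContMDiffAt.comp (s, x) (contMDiffAt_chart hy) (hη.contMDiffAt hU hs x)
  exact ContMDiffAt.comp_of_eq (I' := 𝓘(ℝ, F).prod (𝓡 n)) (g := fun q : F × M =>
    extChartAt (𝓡 n) x₁ (η q.1 q.2)) (f := Prod.map id (extChartAt (𝓡 n) x₀).symm) h2 h1
    (Prod.ext rfl hxz)

/-- Nonnegative as a quotient of square roots, and invertible by the cocycle identity for `η⁻¹ * η`.
-/
theorem jac_pos (g : Metric n M) (η : Diff n M) (x : M) : 0 < jac g η x := by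
  have h : jac g η⁻¹ (η x) * jac g η x = 1 := by
    rw [← jac_mul, inv_mul_cancel, jac_one]
  refine lt_of_le_of_ne (div_nonneg (Real.sqrt_nonneg _) (Real.sqrt_nonneg _)) fun h0 => ?_
  rw [← h0, mul_zero] at h
  exact zero_ne_one h

theorem eventually_jac_eq_chartFamily (g : Metric n M) {η : F → Diff n M} {U : Set F}
    (hη : SmoothFamilyOn η U) (hU : IsOpen U) {s : F} (hs : s ∈ U) {x₀ x₁ x : M}
    (hx : x ∈ (extChartAt (𝓡 n) x₀).source) (hy : η s x ∈ (extChartAt (𝓡 n) x₁).source) :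
    ∀ᶠ q : F × M in 𝓝 (s, x), jac g (η q.1) q.2 =
      chartDensity g x₁ (chartFamily η x₀ x₁ (q.1, extChartAt (𝓡 n) x₀ q.2)) *
        |(fderiv ℝ (fun z => chartFamily η x₀ x₁ (q.1, z)) (extChartAt (𝓡 n) x₀ q.2)).det| /
        chartDensity g x₀ (extChartAt (𝓡 n) x₀ q.2) := by
  have h1 : ∀ᶠ q : F × M in 𝓝 (s, x), q.2 ∈ (extChartAt (𝓡 n) x₀).source :=
    continuous_snd.continuousAt.eventually ((isOpen_extChartAt_source x₀).mem_nhds hx)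
  have h2 : ∀ᶠ q : F × M in 𝓝 (s, x), η q.1 q.2 ∈ (extChartAt (𝓡 n) x₁).source :=
    (hη.contMDiffAt hU hs x).continuousAt.eventually ((isOpen_extChartAt_source x₁).mem_nhds hy)
  filter_upwards [h1, h2] with q hq1 hq2
  rw [eq_div_iff (chartDensity_pos g ((extChartAt (𝓡 n) x₀).map_source hq1)).ne',
    jac_mul_chartDensity g (η q.1) hq1 hq2]
  simp only [chartFamily, (extChartAt (𝓡 n) x₀).left_inv hq1]

/-- The Jacobian depends smoothly on the diffeomorphism and on the point. -/
theorem SmoothFamilyOn.contMDiffAt_jac (g : Metric n M) {η : F → Diff n M} {U : Set F}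
    (hη : SmoothFamilyOn η U) (hU : IsOpen U) {s : F} (hs : s ∈ U) (x : M) :
    ContMDiffAt (𝓘(ℝ, F).prod (𝓡 n)) 𝓘(ℝ, ℝ) ∞ (fun q : F × M => jac g (η q.1) q.2) (s, x) := by
  have hx := mem_extChartAt_source (I := 𝓡 n) x
  have hy := mem_extChartAt_source (I := 𝓡 n) (η s x)
  have hxz := (extChartAt (𝓡 n) x).left_inv hx
  have hev := eventually_jac_eq_chartFamily g hη hU hs hx hy
  have hG := hη.contDiffAt_chartFamily hU hs hx hy
  have hGz : chartFamily η x (η s x) (s, extChartAt (𝓡 n) x x) =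
      extChartAt (𝓡 n) (η s x) (η s x) := by
    simp only [chartFamily, hxz]
  have hA : ContDiffAt ℝ ∞ (fun p : F × 𝔼 =>
      fderiv ℝ (fun z => chartFamily η x (η s x) (p.1, z)) p.2) (s, extChartAt (𝓡 n) x x) := by
    have h1 : ContDiffAt ℝ ∞ (fun p : F × 𝔼 => (fderiv ℝ (chartFamily η x (η s x)) p).comp
        (ContinuousLinearMap.inr ℝ F 𝔼)) (s, extChartAt (𝓡 n) x x) :=
      (hG.fderiv_right (m := ∞) (by simp)).clm_comp contDiffAt_const
    refine h1.congr_of_eventuallyEq ?_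
    have h2 := (hG.of_le (m := 1) (by simp)).eventually (by simp)
    filter_upwards [h2] with p hp using fderiv_partial_right (hp.differentiableAt one_ne_zero)
  -- Needed for smoothness of the absolute value; a zero determinant would make the Jacobian vanish.
  have hdet0 : (fderiv ℝ (fun z => chartFamily η x (η s x) (s, z)) (extChartAt (𝓡 n) x x)).det ≠
      0 := by
    intro h0
    have h1 := hev.self_of_nhds
    simp only [h0, abs_zero, mul_zero, zero_div] at h1
    exact (jac_pos g (η s) x).ne' h1
  have hΨ : ContDiffAt ℝ ∞ (fun p : F × 𝔼 => chartDensity g (η s x) (chartFamily η x (η s x) p) *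
      |(fderiv ℝ (fun z => chartFamily η x (η s x) (p.1, z)) p.2).det| / chartDensity g x p.2)
      (s, extChartAt (𝓡 n) x x) := by
    have hD0 := contDiffAt_chartDensity g ((extChartAt (𝓡 n) x).map_source hx)
    have hD1 := contDiffAt_chartDensity g ((extChartAt (𝓡 n) (η s x)).map_source hy)
    rw [← hGz] at hD1
    have hdet := (contDiff_det.contDiffAt.comp (s, extChartAt (𝓡 n) x x) hA).abs hdet0
    exact ((hD1.comp (s, extChartAt (𝓡 n) x x) hG).mul hdet).div
      (ContDiffAt.comp (g := chartDensity g x) (f := Prod.snd) (s, extChartAt (𝓡 n) x x) hD0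
        contDiffAt_snd)
      (chartDensity_pos g ((extChartAt (𝓡 n) x).map_source hx)).ne'
  have h1 : ContMDiffAt (𝓘(ℝ, F).prod (𝓡 n)) (𝓘(ℝ, F).prod 𝓘(ℝ, 𝔼)) ∞
      (Prod.map id (extChartAt (𝓡 n) x)) (s, x) :=
    contMDiffAt_id.prodMap (contMDiffAt_chart hx)
  have h2 := ContMDiffAt.comp (I' := 𝓘(ℝ, F).prod 𝓘(ℝ, 𝔼)) (s, x)
    (contMDiffAt_prod_self_iff.mpr hΨ) h1
  exact h2.congr_of_eventuallyEq hev

/-- The variation of the Jacobian along a curve through the identity is the divergence. -/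
theorem IsCurveWithVelocity.hasDerivAt_jac_one (g : Metric n M) {c : ℝ → Diff n M}
    {u : (x : M) → TangentSpace (𝓡 n) x} (hc : IsCurveWithVelocity c 1 u) (x : M) :
    HasDerivAt (fun t => jac g (c t) x) (divergence g u x) 0 := by
  obtain ⟨⟨U, hU, h0, hη⟩, hc0, hv⟩ := hc
  have hx := mem_extChartAt_source (I := 𝓡 n) x
  have hxz := (extChartAt (𝓡 n) x).left_inv hx
  -- Since `c 0` is the identity, the chart around `x` serves on both sides. It is also the chart in
  -- which `divergence` is evaluated at `x`.
  have hy : c 0 x ∈ (extChartAt (𝓡 n) x).source := by rw [hc0]; exact hx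
  have hzt := (extChartAt (𝓡 n) x).map_source hx
  have hnhds := extChartAt_target_mem_nhds_of_mem hzt
  have hG := (hη.contDiffAt_chartFamily hU h0 hx hy).of_le (m := 2) (WithTop.coe_le_coe.mpr (le_top : (2 : ℕ∞) ≤ ⊤))
  have hid : ∀ᶠ y in 𝓝 (extChartAt (𝓡 n) x x), chartFamily c x x (0, y) = y := by
    filter_upwards [hnhds] with y hy
    simp only [chartFamily, hc0]
    exact (extChartAt (𝓡 n) x).right_inv hy
  have hw : ∀ᶠ y in 𝓝 (extChartAt (𝓡 n) x x),
      HasDerivAt (fun t => chartFamily c x x (t, y)) (coordField u x y) 0 := by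
    filter_upwards [hnhds] with y hy
    have hys := (extChartAt (𝓡 n) x).map_target hy
    have hcy : c 0 ((extChartAt (𝓡 n) x).symm y) = (extChartAt (𝓡 n) x).symm y := by
      rw [hc0]; rfl
    have h1 : HasMFDerivAt (𝓡 n) 𝓘(ℝ, 𝔼) (extChartAt (𝓡 n) x)
        (c 0 ((extChartAt (𝓡 n) x).symm y)) _ :=
      ((contMDiffAt_chart (by rw [hcy]; exact hys)).mdifferentiableAt (by simp)).hasMFDerivAt
    have h2 := h1.comp (0 : ℝ) (hv ((extChartAt (𝓡 n) x).symm y))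
    let L : ℝ →L[ℝ] 𝔼 := (mfderiv (𝓡 n) 𝓘(ℝ, 𝔼) (extChartAt (𝓡 n) x)
      (c 0 ((extChartAt (𝓡 n) x).symm y))).comp
        (ContinuousLinearMap.toSpanSingleton ℝ (u (c 0 ((extChartAt (𝓡 n) x).symm y))))
    have h3 : HasFDerivAt (fun t => chartFamily c x x (t, y)) L 0 :=
      hasMFDerivAt_iff_hasFDerivAt.mp h2
    have h4 : ∀ p q : M, p = q → (mfderiv (𝓡 n) 𝓘(ℝ, 𝔼) (extChartAt (𝓡 n) x) p (u p) : 𝔼) =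
        mfderiv (𝓡 n) 𝓘(ℝ, 𝔼) (extChartAt (𝓡 n) x) q (u q) := by
      rintro p _ rfl
      rfl
    refine h3.hasDerivAt.congr_deriv ?_
    refine Eq.trans ?_ (h4 _ _ hcy)
    exact congrArg _ (one_smul ℝ (u (c 0 ((extChartAt (𝓡 n) x).symm y))))
  have hD := (contDiffAt_chartDensity g hzt).differentiableAt (by simp)
  have hmain := (hasDerivAt_density_mul_det hG hid hw hD).div_const
    (chartDensity g x (extChartAt (𝓡 n) x x))
  rw [div_eq_inv_mul] at hmain
  refine hmain.congr_of_eventuallyEq ?_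
  exact (Continuous.prodMk_left x).continuousAt.eventually
    (eventually_jac_eq_chartFamily g hη hU h0 hx hy)

/-- The variation of the Jacobian along a curve with velocity `u ∘ η`. -/
theorem IsCurveWithVelocity.hasDerivAt_jac (g : Metric n M) {c : ℝ → Diff n M} {η : Diff n M}
    {u : (x : M) → TangentSpace (𝓡 n) x} (hc : IsCurveWithVelocity c η u) (x : M) :
    HasDerivAt (fun t => jac g (c t) x) (divergence g u (η x) * jac g η x) 0 := by
  -- Right translation by `η⁻¹` moves the curve to the identity without changing its Eulerian
  -- velocity `u`.
  have hc1 : IsCurveWithVelocity (fun t => c t * η⁻¹) 1 u := by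
    obtain ⟨⟨U, hU, h0, hη⟩, hc0, hv⟩ := hc
    refine ⟨⟨U, hU, h0, ?_⟩, by simp [hc0], fun y => hv (η⁻¹ y)⟩
    have h1 : ContMDiff (𝓘(ℝ, ℝ).prod (𝓡 n)) (𝓘(ℝ, ℝ).prod (𝓡 n)) ∞
        (Prod.map id (η⁻¹ : Diff n M) : ℝ × M → ℝ × M) :=
      contMDiff_id.prodMap (η⁻¹ : Diff n M).contMDiff
    exact ContMDiffOn.comp hη h1.contMDiffOn fun q hq => ⟨hq.1, mem_univ _⟩
  have h := (hc1.hasDerivAt_jac_one g (η x)).mul_const (jac g η x)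
  refine h.congr_of_eventuallyEq (Filter.Eventually.of_forall fun t => ?_)
  simp only
  rw [← jac_mul, inv_mul_cancel_right]

/-- The field is the tangent map of `(s, x) ↦ η s x` applied to the vector `(a, 0)` at `(s, (η s)⁻¹
x)`, which depends smoothly on `x`. -/
theorem SmoothFamilyOn.isSmoothField_familyVelocity {η : F → Diff n M} {U : Set F}
    (hη : SmoothFamilyOn η U) (hU : IsOpen U) {s : F} (hs : s ∈ U) (a : F) :
    IsSmoothField (familyVelocity η s a) := by
  have : IsManifold (𝓡 n) 1 M := IsManifold.of_le (n := ∞) (by simp)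
  have hopen : IsOpen (U ×ˢ (univ : Set M)) := hU.prod isOpen_univ
  have h := ContMDiffOn.contMDiffOn_tangentMapWithin (m := ∞) hη (by simp) hopen.uniqueMDiffOn
  have hzero : ContMDiff (𝓡 n) (𝓡 n).tangent ∞
      (fun x : M => (⟨x, 0⟩ : TangentBundle (𝓡 n) M)) :=
    Bundle.contMDiff_zeroSection ℝ (TangentSpace (𝓡 n) : M → Type _)
  have hsec : ContMDiff (𝓡 n) (𝓘(ℝ, F).prod (𝓡 n)).tangent ∞ (fun x : M =>
      (equivTangentBundleProd 𝓘(ℝ, F) F (𝓡 n) M).symm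
        ((⟨s, a⟩ : TangentBundle 𝓘(ℝ, F) F), (⟨(η s)⁻¹ x, 0⟩ : TangentBundle (𝓡 n) M))) :=
    contMDiff_equivTangentBundleProd_symm.comp
      (contMDiff_const.prodMk (hzero.comp ((η s)⁻¹ : Diff n M).contMDiff))
  have h2 := h.comp hsec.contMDiffOn (s := univ) (fun x _ => ⟨hs, mem_univ _⟩)
  rw [contMDiffOn_univ] at h2
  refine h2.congr fun x => ?_
  have hmk : ∀ {x y : M} (_ : x = y) (v : 𝔼), (⟨x, v⟩ : TangentBundle (𝓡 n) M) = ⟨y, v⟩ := by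
    rintro x _ rfl v
    rfl
  have hx : η s ((η s)⁻¹ x) = x := by rw [← Diff.mul_apply, mul_inv_cancel, Diff.one_apply]
  refine (hmk hx.symm _).trans ?_
  simp only [Function.comp, tangentMapWithin]
  rw [mfderivWithin_of_isOpen hopen ⟨hs, mem_univ _⟩]
  rfl

end Families

/-! ### The Riemannian volume and the change of variables -/

section Volume

variable {n : ℕ} {M : Type*} [TopologicalSpace M] [ChartedSpace (EuclideanSpace ℝ (Fin n)) M]
  [IsManifold (𝓡 n) ∞ M]

local notation "𝔼" => EuclideanSpace ℝ (Fin n)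

theorem continuous_jac (g : Metric n M) (η : Diff n M) : Continuous (jac g η) := by
  -- A single diffeomorphism is treated as a constant family.
  have hη : SmoothFamilyOn (fun _ : ℝ => η) univ :=
    (η.contMDiff.comp contMDiff_snd).contMDiffOn
  refine continuous_iff_continuousAt.mpr fun x => ?_
  exact (hη.contMDiffAt_jac g isOpen_univ (mem_univ 0) x).continuousAt.comp
    (f := fun x : M => ((0 : ℝ), x)) (Continuous.prodMk_right (0 : ℝ)).continuousAt

variable [MeasurableSpace M] [BorelSpace M]

omit [IsManifold (𝓡 n) ∞ M] in
theorem measurableSet_chart_source (x₀ : M) : MeasurableSet (extChartAt (𝓡 n) x₀).source :=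
  (isOpen_extChartAt_source x₀).measurableSet

omit [IsManifold (𝓡 n) ∞ M] in
theorem measurableSet_chart_target_inter (x₀ : M) {A : Set M} (hA : MeasurableSet A) :
    MeasurableSet ((extChartAt (𝓡 n) x₀).target ∩ (extChartAt (𝓡 n) x₀).symm ⁻¹' A) := by
  have h := (continuousOn_iff_continuous_domRestrict.mp
    (continuousOn_extChartAt_symm (I := 𝓡 n) x₀)).measurable hA
  convert MeasurableSet.subtype_image (isOpen_extChartAt_target x₀).measurableSet h using 1
  ext z
  simp [and_comm]

theorem setLIntegral_chartVolume (g : Metric n M) (x₀ : M) {A : Set M} (hA : MeasurableSet A)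
    {f : M → ENNReal} (hf : Measurable f) :
    ∫⁻ x in A, f x ∂(chartVolume g x₀) =
      ∫⁻ z in (extChartAt (𝓡 n) x₀).target ∩ (extChartAt (𝓡 n) x₀).symm ⁻¹' A,
        ENNReal.ofReal (chartDensity g x₀ z) * f ((extChartAt (𝓡 n) x₀).symm z) := by
  have ht : MeasurableSet (extChartAt (𝓡 n) x₀).target := (isOpen_extChartAt_target x₀).measurableSet
  have hs : AEMeasurable (extChartAt (𝓡 n) x₀).symm
      ((volume : Measure 𝔼).restrict (extChartAt (𝓡 n) x₀).target) :=
    (continuousOn_extChartAt_symm x₀).aemeasurable ht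
  have hD : AEMeasurable (fun z => ENNReal.ofReal (chartDensity g x₀ z))
      ((volume : Measure 𝔼).restrict (extChartAt (𝓡 n) x₀).target) := by
    have hc : ContinuousOn (chartDensity g x₀) (extChartAt (𝓡 n) x₀).target := fun z hz =>
      (contDiffAt_chartDensity g hz).continuousAt.continuousWithinAt
    exact (hc.aemeasurable ht).ennreal_ofReal
  -- The inverse chart is controlled only on its target, so measurability is almost everywhere and
  -- passes to the weighted measure by absolute continuity.
  have hs' := hs.mono_ac (withDensity_absolutelyContinuous _
    fun z => ENNReal.ofReal (chartDensity g x₀ z))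
  rw [← lintegral_indicator hA, chartVolume,
    lintegral_map' (hf.indicator hA).aemeasurable hs',
    lintegral_withDensity_eq_lintegral_mul₀' hD
      (g := fun z => A.indicator f ((extChartAt (𝓡 n) x₀).symm z))
      ((hf.indicator hA).comp_aemeasurable hs'),
    ← lintegral_indicator ht, ← lintegral_indicator (measurableSet_chart_target_inter x₀ hA)]
  congr 1
  ext z
  by_cases h1 : z ∈ (extChartAt (𝓡 n) x₀).target <;>
    by_cases h2 : (extChartAt (𝓡 n) x₀).symm z ∈ A <;>
      simp only [indicator, mem_inter_iff, mem_preimage, Pi.mul_apply, h1, h2, and_self, and_true,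
        and_false, if_true, if_false, mul_zero]

theorem chartVolume_apply (g : Metric n M) (x₀ : M) {A : Set M} (hA : MeasurableSet A) :
    chartVolume g x₀ A =
      ∫⁻ z in (extChartAt (𝓡 n) x₀).target ∩ (extChartAt (𝓡 n) x₀).symm ⁻¹' A,
        ENNReal.ofReal (chartDensity g x₀ z) := by
  have h := setLIntegral_chartVolume g x₀ hA (f := fun _ => 1) measurable_const
  simpa using h

theorem chartVolume_compl_source (g : Metric n M) (x₀ : M) :
    chartVolume g x₀ (extChartAt (𝓡 n) x₀).sourceᶜ = 0 := by
  rw [chartVolume_apply g x₀ (measurableSet_chart_source x₀).compl]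
  have h : (extChartAt (𝓡 n) x₀).target ∩
      (extChartAt (𝓡 n) x₀).symm ⁻¹' (extChartAt (𝓡 n) x₀).sourceᶜ = ∅ := by
    ext z
    simp only [mem_inter_iff, mem_preimage, mem_compl_iff, mem_empty_iff_false, iff_false, not_and,
      not_not]
    exact fun hz => (extChartAt (𝓡 n) x₀).map_target hz
  rw [h]
  simp

omit [IsManifold (𝓡 n) ∞ M] in
theorem measurableSet_diff_image (η : Diff n M) {A : Set M} (hA : MeasurableSet A) :
    MeasurableSet (η '' A) := by
  rw [show η '' A = η.symm ⁻¹' A from η.toEquiv.image_eq_preimage_symm A]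
  exact η.symm.contMDiff.continuous.measurable hA

/-- The change of variables formula for sets inside charts. -/
theorem chartVolume_image (g : Metric n M) (η : Diff n M) {x₀ x₁ : M} {A : Set M}
    (hA : MeasurableSet A) (h0 : A ⊆ (extChartAt (𝓡 n) x₀).source)
    (h1 : η '' A ⊆ (extChartAt (𝓡 n) x₁).source) :
    chartVolume g x₁ (η '' A) = ∫⁻ x in A, ENNReal.ofReal (jac g η x) ∂(chartVolume g x₀) := by
  rw [chartVolume_apply g x₁ (measurableSet_diff_image η hA),
    setLIntegral_chartVolume g x₀ hA (continuous_jac g η).measurable.ennreal_ofReal]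
  set B := (extChartAt (𝓡 n) x₀).target ∩ (extChartAt (𝓡 n) x₀).symm ⁻¹' A with hB
  set G : 𝔼 → 𝔼 := fun z => extChartAt (𝓡 n) x₁ (η ((extChartAt (𝓡 n) x₀).symm z)) with hG
  have hmem : ∀ z ∈ B, η ((extChartAt (𝓡 n) x₀).symm z) ∈ (extChartAt (𝓡 n) x₁).source :=
    fun z hz => h1 (mem_image_of_mem η hz.2)
  have himage : (extChartAt (𝓡 n) x₁).target ∩ (extChartAt (𝓡 n) x₁).symm ⁻¹' (η '' A) =
      G '' B := by
    ext w
    constructor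
    · rintro ⟨hw, x, hx, hxw⟩
      refine ⟨extChartAt (𝓡 n) x₀ x, ⟨(extChartAt (𝓡 n) x₀).map_source (h0 hx), ?_⟩, ?_⟩
      · simpa only [mem_preimage, (extChartAt (𝓡 n) x₀).left_inv (h0 hx)] using hx
      · simp only [hG, (extChartAt (𝓡 n) x₀).left_inv (h0 hx), hxw,
          (extChartAt (𝓡 n) x₁).right_inv hw]
    · rintro ⟨z, hz, rfl⟩
      refine ⟨(extChartAt (𝓡 n) x₁).map_source (hmem z hz), ?_⟩
      simp only [hG, mem_preimage, (extChartAt (𝓡 n) x₁).left_inv (hmem z hz)]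
      exact mem_image_of_mem η hz.2
  have hinj : InjOn G B := by
    intro z hz w hw hzw
    have h2 := (extChartAt (𝓡 n) x₁).injOn (hmem z hz) (hmem w hw) hzw
    exact (extChartAt (𝓡 n) x₀).symm.injOn hz.1 hw.1 (η.injective h2)
  have hderiv : ∀ z ∈ B, HasFDerivWithinAt G (fderiv ℝ G z) B z := by
    intro z hz
    have h2 : ContMDiffAt (𝓡 n) 𝓘(ℝ, 𝔼) ∞ G z :=
      (contMDiffAt_chart (hmem z hz)).comp z
        ((η.contMDiff _).comp z (contMDiffAt_chart_symm hz.1))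
    exact ((contMDiffAt_iff_contDiffAt.mp h2).differentiableAt
      (by simp)).hasFDerivAt.hasFDerivWithinAt
  rw [himage, lintegral_image_eq_lintegral_abs_det_fderiv_mul volume
    (measurableSet_chart_target_inter x₀ hA) hderiv hinj]
  refine setLIntegral_congr_fun (measurableSet_chart_target_inter x₀ hA) fun z hz => ?_
  have h2 := jac_mul_chartDensity g η (h0 hz.2) (hmem z hz)
  rw [(extChartAt (𝓡 n) x₀).right_inv hz.1] at h2
  rw [← ENNReal.ofReal_mul (abs_nonneg _), ← ENNReal.ofReal_mul (chartDensity_pos g hz.1).le,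
    mul_comm (chartDensity g x₀ z), h2, mul_comm]

/-- A change of chart is the change of variables for the identity diffeomorphism, whose Jacobian is
1. -/
theorem chartVolume_eq_of_subset (g : Metric n M) {x₀ x₁ : M} {A : Set M} (hA : MeasurableSet A)
    (h0 : A ⊆ (extChartAt (𝓡 n) x₀).source) (h1 : A ⊆ (extChartAt (𝓡 n) x₁).source) :
    chartVolume g x₁ A = chartVolume g x₀ A := by
  have himage : (1 : Diff n M) '' A = A := image_id A
  have h := chartVolume_image g 1 hA h0 (himage.subset.trans h1)
  simp only [jac_one, ENNReal.ofReal_one] at h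
  rwa [himage, setLIntegral_one] at h

/-- Outside its own chart the measure of `x₁` vanishes, and on the overlap the two measures agree.
-/
theorem chartVolume_le_of_subset (g : Metric n M) {x₀ : M} (x₁ : M) {A : Set M}
    (hA : MeasurableSet A) (h0 : A ⊆ (extChartAt (𝓡 n) x₀).source) :
    chartVolume g x₁ A ≤ chartVolume g x₀ A := by
  have hs := measurableSet_chart_source (n := n) x₁
  have h1 : chartVolume g x₁ (A \ (extChartAt (𝓡 n) x₁).source) = 0 :=
    measure_mono_null (fun x hx => hx.2) (chartVolume_compl_source g x₁)
  rw [← measure_inter_add_sdiff A hs, h1, add_zero,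
    chartVolume_eq_of_subset g (hA.inter hs) (inter_subset_left.trans h0) inter_subset_right]
  exact measure_mono inter_subset_left

/-- On the domain of a chart the Riemannian volume is the volume of the chart. -/
theorem riemVol_restrict_source (g : Metric n M) (x₀ : M) :
    (riemVol g).restrict (extChartAt (𝓡 n) x₀).source =
      (chartVolume g x₀).restrict (extChartAt (𝓡 n) x₀).source := by
  have hs := measurableSet_chart_source (n := n) x₀
  refine le_antisymm ?_ (Measure.restrict_mono subset_rfl (le_iSup (chartVolume g) x₀))
  -- The right side is an upper bound for every chart measure, hence for their supremum; restricted
  -- to the source, its second term disappears.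
  have h : riemVol g ≤ (chartVolume g x₀).restrict (extChartAt (𝓡 n) x₀).source +
      (riemVol g).restrict (extChartAt (𝓡 n) x₀).sourceᶜ := by
    refine iSup_le fun x₁ => ?_
    rw [← Measure.restrict_add_restrict_compl (μ := chartVolume g x₁) hs]
    refine add_le_add ?_ (Measure.restrict_mono subset_rfl (le_iSup (chartVolume g) x₁))
    refine Measure.le_iff.mpr fun A hA => ?_
    rw [Measure.restrict_apply hA, Measure.restrict_apply hA]
    exact chartVolume_le_of_subset g x₁ (hA.inter hs) inter_subset_right
  refine (Measure.restrict_mono subset_rfl h).trans ?_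
  rw [Measure.restrict_add, Measure.restrict_restrict hs, Measure.restrict_restrict hs, inter_self,
    inter_compl_self, Measure.restrict_empty, add_zero]

theorem riemVol_restrict_of_subset (g : Metric n M) {x₀ : M} {A : Set M}
    (h0 : A ⊆ (extChartAt (𝓡 n) x₀).source) :
    (riemVol g).restrict A = (chartVolume g x₀).restrict A := by
  rw [← Measure.restrict_restrict_of_subset h0, riemVol_restrict_source,
    Measure.restrict_restrict_of_subset h0]

theorem isLocallyFiniteMeasure_riemVol (g : Metric n M) : IsLocallyFiniteMeasure (riemVol g) := by
  refine ⟨fun x => ?_⟩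
  have hx := mem_extChartAt_source (I := 𝓡 n) x
  have hzt := (extChartAt (𝓡 n) x).map_source hx
  set z₀ := extChartAt (𝓡 n) x x
  -- a neighbourhood in the chart of finite volume on which the density is bounded
  have hc := (contDiffAt_chartDensity g hzt).continuousAt
  have h1 : {z | chartDensity g x z < chartDensity g x z₀ + 1} ∈ 𝓝 z₀ :=
    hc.eventually (gt_mem_nhds (lt_add_one _))
  have h2 : Metric.ball z₀ 1 ∩ {z | chartDensity g x z < chartDensity g x z₀ + 1} ∈ 𝓝 z₀ :=
    Filter.inter_mem (Metric.ball_mem_nhds z₀ one_pos) h1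
  obtain ⟨V, hVs, hVo, hzV⟩ := mem_nhds_iff.mp h2
  have hpre : IsOpen ((extChartAt (𝓡 n) x).source ∩ extChartAt (𝓡 n) x ⁻¹' V) :=
    (continuousOn_extChartAt x).isOpen_inter_preimage (isOpen_extChartAt_source x) hVo
  refine ⟨_, hpre.mem_nhds ⟨hx, hzV⟩, ?_⟩
  rw [← Measure.restrict_apply_self, riemVol_restrict_of_subset g inter_subset_left,
    Measure.restrict_apply_self, chartVolume_apply g x hpre.measurableSet]
  set B := (extChartAt (𝓡 n) x).target ∩ (extChartAt (𝓡 n) x).symm ⁻¹'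
    ((extChartAt (𝓡 n) x).source ∩ extChartAt (𝓡 n) x ⁻¹' V)
  have hB : B ⊆ V := fun z hz => by
    have := hz.2.2
    rwa [mem_preimage, (extChartAt (𝓡 n) x).right_inv hz.1] at this
  calc ∫⁻ z in B, ENNReal.ofReal (chartDensity g x z)
      ≤ ∫⁻ z in V, ENNReal.ofReal (chartDensity g x z) := lintegral_mono_set hB
    _ ≤ ∫⁻ _ in V, ENNReal.ofReal (chartDensity g x z₀ + 1) :=
        setLIntegral_mono measurable_const fun z hz => ENNReal.ofReal_le_ofReal (hVs hz).2.le
    _ = ENNReal.ofReal (chartDensity g x z₀ + 1) * volume V := setLIntegral_const _ _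
    _ < ⊤ := ENNReal.mul_lt_top ENNReal.ofReal_lt_top
        ((measure_mono fun z hz => (hVs hz).1).trans_lt measure_ball_lt_top)

theorem isFiniteMeasure_riemVol [CompactSpace M] (g : Metric n M) :
    IsFiniteMeasure (riemVol g) := by
  have := isLocallyFiniteMeasure_riemVol g
  infer_instance

/-- The pullback of the Riemannian volume by a diffeomorphism `η` is `(Jac_μ η) μ`. -/
theorem map_symm_riemVol [CompactSpace M] (g : Metric n M) (η : Diff n M) :
    (riemVol g).map η.symm =
      (riemVol g).withDensity (fun x => ENNReal.ofReal (jac g η x)) := by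
  -- On `W x` one chart covers the points and one chart covers their images. Compactness leaves
  -- finitely many such sets, and equality of measures is tested on each.
  let W : M → Set M := fun x =>
    (extChartAt (𝓡 n) x).source ∩ η ⁻¹' (extChartAt (𝓡 n) (η x)).source
  have hWo : ∀ x, IsOpen (W x) := fun x => (isOpen_extChartAt_source x).inter
    ((isOpen_extChartAt_source (η x)).preimage η.contMDiff.continuous)
  obtain ⟨t, ht⟩ := isCompact_univ.elim_nhds_subcover W fun x _ =>
    (hWo x).mem_nhds ⟨mem_extChartAt_source x, mem_extChartAt_source (η x)⟩
  have hcover : ⋃ i : t, W i = univ := by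
    rw [iUnion_subtype]
    exact univ_subset_iff.mp ht.2
  refine Measure.ext_of_iUnion_eq_univ hcover fun i => Measure.ext fun A hA => ?_
  have hAW := hA.inter (hWo i).measurableSet
  rw [Measure.restrict_apply hA, Measure.restrict_apply hA,
    Measure.map_apply η.symm.contMDiff.continuous.measurable hAW, withDensity_apply _ hAW]
  have himage : η.symm ⁻¹' (A ∩ W i) = η '' (A ∩ W i) :=
    (η.toEquiv.image_eq_preimage_symm _).symm
  have h0 : A ∩ W i ⊆ (extChartAt (𝓡 n) (i : M)).source := fun x hx => hx.2.1
  have h1 : η '' (A ∩ W i) ⊆ (extChartAt (𝓡 n) (η i)).source := by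
    rintro _ ⟨x, hx, rfl⟩
    exact hx.2.2
  rw [himage, riemVol_restrict_of_subset g h0, ← chartVolume_image g η hAW h0 h1,
    ← Measure.restrict_apply_self, riemVol_restrict_of_subset g h1, Measure.restrict_apply_self]

/-- The change of variables formula for a diffeomorphism. -/
theorem integral_comp_mul_jac [CompactSpace M] (g : Metric n M) (η : Diff n M) (f : M → ℝ) :
    ∫ x, f (η x) * jac g η x ∂(riemVol g) = ∫ x, f x ∂(riemVol g) := by
  have hemb : MeasurableEmbedding η.symm :=
    (η.symm.toHomeomorph.measurableEmbedding :)
  have h1 : ∫ x, f (η x) ∂((riemVol g).map η.symm) = ∫ x, f x ∂(riemVol g) := by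
    rw [hemb.integral_map]
    simp
  rw [← h1, map_symm_riemVol, integral_withDensity_eq_integral_toReal_smul
    (continuous_jac g η).measurable.ennreal_ofReal (by simp)]
  refine integral_congr_ae (Filter.Eventually.of_forall fun x => ?_)
  simp only [ENNReal.toReal_ofReal (jac_pos g η x).le, smul_eq_mul, mul_comm]

end Volume

/-! ### Comparison of the quotient metric with the Fisher–Rao metric -/

section FisherRao

variable {n : ℕ} {M : Type*} [TopologicalSpace M] [ChartedSpace (EuclideanSpace ℝ (Fin n)) M]
  [IsManifold (𝓡 n) ∞ M]

local notation "𝔼" => EuclideanSpace ℝ (Fin n)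

/-- A lift enters the variation of the density only through its divergence, which is what the `Ḣ¹`
metric sees. -/
theorem ProjectsTo.eq_divergence_mul_jac {g : Metric n M} {η : Diff n M}
    {u : (x : M) → TangentSpace (𝓡 n) x} {α : M → ℝ} (h : ProjectsTo g η u α) (x : M) :
    α x = divergence g u (η x) * jac g η x := by
  obtain ⟨c, hc, hα⟩ := h
  exact (hα x).unique (hc.hasDerivAt_jac g x)

/-- The partial derivative of a smooth function on `F × M` along `F` is continuous on `M`. -/
theorem continuousAt_fderiv_partial {F : Type*} [NormedAddCommGroup F] [NormedSpace ℝ F]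
    {ρ : F → M → ℝ} {s : F} {x : M}
    (hρ : ContMDiffAt (𝓘(ℝ, F).prod (𝓡 n)) 𝓘(ℝ, ℝ) ∞ (fun q : F × M => ρ q.1 q.2) (s, x)) (v : F) :
    ContinuousAt (fun y => fderiv ℝ (fun s' => ρ s' y) s v) x := by
  have hx := mem_extChartAt_source (I := 𝓡 n) x
  have h1 : ContMDiffAt (𝓘(ℝ, F).prod 𝓘(ℝ, 𝔼)) (𝓘(ℝ, F).prod (𝓡 n)) ∞
      (Prod.map id (extChartAt (𝓡 n) x).symm) (s, extChartAt (𝓡 n) x x) :=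
    contMDiffAt_id.prodMap (contMDiffAt_chart_symm ((extChartAt (𝓡 n) x).map_source hx))
  have h2 := contMDiffAt_prod_self_iff.mp (ContMDiffAt.comp_of_eq (I' := 𝓘(ℝ, F).prod (𝓡 n))
    (g := fun q : F × M => ρ q.1 q.2) (f := Prod.map id (extChartAt (𝓡 n) x).symm) hρ h1
    (Prod.ext rfl ((extChartAt (𝓡 n) x).left_inv hx)))
  set f : F × 𝔼 → ℝ := (fun q : F × M => ρ q.1 q.2) ∘ Prod.map id (extChartAt (𝓡 n) x).symm
  have hmap : ContinuousAt (fun y => (s, extChartAt (𝓡 n) x y)) x :=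
    continuousAt_const.prodMk (continuousAt_extChartAt x)
  have h3 : ContinuousAt (fun y => fderiv ℝ f (s, extChartAt (𝓡 n) x y) (v, 0)) x := by
    have h4 : ContinuousAt (fderiv ℝ f) (s, extChartAt (𝓡 n) x x) :=
      (h2.fderiv_right (m := ∞) (by simp)).continuousAt
    exact (ContinuousAt.comp (f := fun y => (s, extChartAt (𝓡 n) x y)) h4 hmap).clm_apply
      continuousAt_const
  refine h3.congr ?_
  have h5 := hmap.eventually ((h2.of_le (m := 1) (by simp)).eventually (by simp))
  filter_upwards [h5, (isOpen_extChartAt_source x).mem_nhds hx] with y hy hys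
  have h6 := fderiv_partial_left (hy.differentiableAt one_ne_zero)
  simp only [f, Function.comp, Prod.map, id, (extChartAt (𝓡 n) x).left_inv hys] at h6
  rw [h6]
  rfl

variable [MeasurableSpace M] {k : ℕ}

theorem IsStatisticalModel.contMDiffAt {g : Metric n M} {E : Set (EuclideanSpace ℝ (Fin k))}
    {ρ : EuclideanSpace ℝ (Fin k) → M → ℝ} (h : IsStatisticalModel g E ρ) (hE : IsOpen E)
    {s : EuclideanSpace ℝ (Fin k)} (hs : s ∈ E) (x : M) :
    ContMDiffAt (𝓘(ℝ, EuclideanSpace ℝ (Fin k)).prod (𝓡 n)) 𝓘(ℝ, ℝ) ∞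
      (fun q : EuclideanSpace ℝ (Fin k) × M => ρ q.1 q.2) (s, x) :=
  h.smooth.contMDiffAt ((hE.prod isOpen_univ).mem_nhds ⟨hs, mem_univ x⟩)

theorem IsStatisticalModel.differentiableAt {g : Metric n M} {E : Set (EuclideanSpace ℝ (Fin k))}
    {ρ : EuclideanSpace ℝ (Fin k) → M → ℝ} (h : IsStatisticalModel g E ρ) (hE : IsOpen E)
    {s : EuclideanSpace ℝ (Fin k)} (hs : s ∈ E) (x : M) :
    DifferentiableAt ℝ (fun s' => ρ s' x) s := by
  have h1 : ContMDiffAt 𝓘(ℝ, EuclideanSpace ℝ (Fin k)) 𝓘(ℝ, ℝ) ∞ (fun s' => ρ s' x) s :=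
    (h.contMDiffAt hE hs x).comp s (contMDiffAt_id.prodMk contMDiffAt_const)
  exact (contMDiffAt_iff_contDiffAt.mp h1).differentiableAt (by simp)

theorem isHDotValue_hDotMetric {g : Metric n M} {p : Dens g} {α β : M → ℝ}
    (h : ∃ r, IsHDotValue g p α β r) : IsHDotValue g p α β (hDotMetric g p α β) := by
  rw [hDotMetric, dif_pos h]
  exact h.choose_spec

variable [BorelSpace M] [CompactSpace M]

/-- After the substitution by `η` the integrand is `(div u ∘ η)(div v ∘ η) Jac η = α β / Jac η`.
This gives independence of the lifts, and the comparison with Fisher–Rao. -/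
theorem IsHDotValue.eq_integral {g : Metric n M} {p : Dens g} {α β : M → ℝ} {r : ℝ}
    (h : IsHDotValue g p α β r) :
    r = (1 / 4) * ∫ x, α x * β x / density g p x ∂(riemVol g) := by
  obtain ⟨η, u, v, rfl, -, -, hu, hv, rfl⟩ := h
  rw [hDotInner, ← integral_comp_mul_jac g η]
  congr 2
  ext x
  have hj := (jac_pos g η x).ne'
  rw [density_proj, hu.eq_divergence_mul_jac, hv.eq_divergence_mul_jac]
  field_simp

/-- The Fisher-Rao metric on a pair of tangent vectors. -/
theorem IsStatisticalModel.sum_fisherRao {g : Metric n M} {E : Set (EuclideanSpace ℝ (Fin k))}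
    {ρ : EuclideanSpace ℝ (Fin k) → M → ℝ} (h : IsStatisticalModel g E ρ) (hE : IsOpen E)
    {s : EuclideanSpace ℝ (Fin k)} (hs : s ∈ E) (a b : EuclideanSpace ℝ (Fin k)) :
    ∑ i, ∑ j, fisherRao g ρ s i j * a i * b j =
      ∫ x, modelTangent ρ s a x * modelTangent ρ s b x / ρ s x ∂(riemVol g) := by
  have := isFiniteMeasure_riemVol g
  have hcont : ∀ v, Continuous (modelTangent ρ s v) := fun v =>
    continuous_iff_continuousAt.mpr fun x => continuousAt_fderiv_partial (h.contMDiffAt hE hs x) v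
  have hρ : Continuous (ρ s) := continuous_iff_continuousAt.mpr fun x =>
    (h.contMDiffAt hE hs x).continuousAt.comp
      (f := fun y : M => (s, y)) (Continuous.prodMk_right s).continuousAt
  have hI : ∀ i j, fisherRao g ρ s i j = ∫ x, modelTangent ρ s (EuclideanSpace.single i 1) x *
      modelTangent ρ s (EuclideanSpace.single j 1) x / ρ s x ∂(riemVol g) := by
    intro i j
    unfold fisherRao
    congr 1
    ext x
    have h0 := (h.pos s hs x).ne'
    have h1 := ((h.differentiableAt hE hs x).hasFDerivAt.log h0).fderiv
    rw [h1]
    simp only [modelTangent, smul_apply, smul_eq_mul]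
    field_simp
  -- Continuous on a compact space of finite volume; this justifies exchanging the finite sums with
  -- the integral.
  have hint : ∀ v w, Integrable (fun x => modelTangent ρ s v x * modelTangent ρ s w x / ρ s x)
      (riemVol g) := fun v w =>
    (((hcont v).mul (hcont w)).div hρ fun x => (h.pos s hs x).ne').integrable_of_hasCompactSupport
      (HasCompactSupport.of_compactSpace _)
  have hlin : ∀ v x, modelTangent ρ s v x =
      ∑ i, v i * modelTangent ρ s (EuclideanSpace.single i 1) x := by
    intro v x
    have hv : v = ∑ i, v i • EuclideanSpace.single i (1 : ℝ) := by
      ext j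
      simp [Finset.sum_apply, Pi.single_apply]
    conv_lhs => rw [modelTangent, hv]
    simp [modelTangent]
  have hsum : ∀ x, modelTangent ρ s a x * modelTangent ρ s b x / ρ s x = ∑ i, ∑ j,
      modelTangent ρ s (EuclideanSpace.single i 1) x *
        modelTangent ρ s (EuclideanSpace.single j 1) x / ρ s x * a i * b j := by
    intro x
    rw [hlin a, hlin b, Finset.sum_mul_sum, Finset.sum_div]
    refine Finset.sum_congr rfl fun i _ => ?_
    rw [Finset.sum_div]
    refine Finset.sum_congr rfl fun j _ => ?_
    ring
  have hint' : ∀ i j, Integrable (fun x => modelTangent ρ s (EuclideanSpace.single i 1) x *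
        modelTangent ρ s (EuclideanSpace.single j 1) x / ρ s x * a i * b j) (riemVol g) :=
    fun i j => ((hint _ _).mul_const _).mul_const _
  simp_rw [hsum]
  rw [integral_finsetSum _ fun i _ => integrable_finsetSum _ fun j _ => hint' i j]
  refine Finset.sum_congr rfl fun i _ => ?_
  rw [integral_finsetSum _ fun j _ => hint' i j]
  refine Finset.sum_congr rfl fun j _ => ?_
  rw [integral_mul_const, integral_mul_const, hI]

theorem IsSmoothInto.isStatisticalModel {g : Metric n M} {E : Set (EuclideanSpace ℝ (Fin k))}
    {P : EuclideanSpace ℝ (Fin k) → Dens g} (hP : IsSmoothInto g E P) :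
    IsStatisticalModel g E (fun s => density g (P s)) := by
  refine ⟨fun q hq => ?_, fun s _ x => ?_, fun s _ => ?_⟩
  · obtain ⟨U, hU, hs, -, η, hη, hproj⟩ := hP q.1 hq.1
    refine ((hη.contMDiffAt_jac g hU hs q.2).congr_of_eventuallyEq ?_).contMDiffWithinAt
    filter_upwards [continuous_fst.continuousAt.eventually (hU.mem_nhds hs)] with q' hq'
    rw [← hproj _ hq', density_proj]
  · obtain ⟨η, hη⟩ := Quotient.exists_rep (P s)
    rw [← hη]
    exact jac_pos g η x
  · obtain ⟨η, hη⟩ := Quotient.exists_rep (P s)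
    -- Conservation of mass is the change of variables for the constant function 1.
    have h := integral_comp_mul_jac g η fun _ => 1
    simp only [one_mul, integral_const, smul_eq_mul, mul_one] at h
    rw [← hη]
    exact h

/-- Along the line `s + t • v` a local lift `η` of `P` is a curve in `Diff(M)` over the given
densities, so its velocity lifts the tangent vector. Both directions use the same `η s`, as the
metric requires. -/
theorem IsSmoothInto.exists_isHDotValue {g : Metric n M} {E : Set (EuclideanSpace ℝ (Fin k))}
    {P : EuclideanSpace ℝ (Fin k) → Dens g} (hP : IsSmoothInto g E P) (hE : IsOpen E)
    {s : EuclideanSpace ℝ (Fin k)} (hs : s ∈ E) (a b : EuclideanSpace ℝ (Fin k)) :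
    ∃ r, IsHDotValue g (P s) (modelTangent (fun s => density g (P s)) s a)
      (modelTangent (fun s => density g (P s)) s b) r := by
  have hmodel := hP.isStatisticalModel
  obtain ⟨U, hU, hsU, -, η, hη, hproj⟩ := hP s hs
  have hlift : ∀ v, ProjectsTo g (η s) (familyVelocity η s v)
      (modelTangent (fun s => density g (P s)) s v) := by
    intro v
    refine ⟨fun t => η (s + t • v), hη.isCurveWithVelocity hU hsU v, fun x => ?_⟩
    have hline : HasDerivAt (fun t : ℝ => s + t • v) v 0 := by
      simpa using ((hasDerivAt_id (0 : ℝ)).smul_const v).const_add s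
    have h0 : s + (0 : ℝ) • v = s := by simp
    have h1 : HasFDerivAt (fun s' => density g (P s') x)
        (fderiv ℝ (fun s' => density g (P s') x) s) (s + (0 : ℝ) • v) := by
      rw [h0]
      exact (hmodel.differentiableAt hE hs x).hasFDerivAt
    refine (h1.comp_hasDerivAt (0 : ℝ) hline).congr_of_eventuallyEq ?_
    have h2 : ∀ᶠ t : ℝ in 𝓝 0, s + t • v ∈ U :=
      hline.continuousAt.eventually (hU.mem_nhds (by simpa using hsU))
    filter_upwards [h2] with t ht
    simp only [Function.comp, hproj _ ht]
  exact ⟨_, η s, familyVelocity η s a, familyVelocity η s b, hproj s hsU,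
    hη.isSmoothField_familyVelocity hU hsU a, hη.isSmoothField_familyVelocity hU hsU b,
    hlift a, hlift b, rfl⟩

theorem IsStatisticalModel.sum_fisherRao_eq {g : Metric n M} {E : Set (EuclideanSpace ℝ (Fin k))}
    {ρ : EuclideanSpace ℝ (Fin k) → M → ℝ} (h : IsStatisticalModel g E ρ) (hE : IsOpen E)
    {s : EuclideanSpace ℝ (Fin k)} (hs : s ∈ E) {p : Dens g} (hp : density g p = ρ s)
    {a b : EuclideanSpace ℝ (Fin k)} {r : ℝ}
    (hr : IsHDotValue g p (modelTangent ρ s a) (modelTangent ρ s b) r) :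
    ∑ i, ∑ j, fisherRao g ρ s i j * a i * b j = 4 * r := by
  rw [h.sum_fisherRao hE hs, hr.eq_integral, hp]
  ring

end FisherRao

end DensityGeometry

end

theorem mainTheorem6 {n : ℕ} {M : Type*} [TopologicalSpace M] [T2Space M] [CompactSpace M]
    [ChartedSpace (EuclideanSpace ℝ (Fin n)) M] [IsManifold (𝓡 n) ∞ M]
    [MeasurableSpace M] [BorelSpace M] (g : DensityGeometry.Metric n M) :
    -- the right-invariant metric on `Diff(M)` descends to `Dens(M)`
    (∀ (p : DensityGeometry.Dens g) (α β : M → ℝ) (r r' : ℝ),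
      DensityGeometry.IsHDotValue g p α β r → DensityGeometry.IsHDotValue g p α β r' → r = r') ∧
    -- on every smooth family in `Dens(M)` it restricts to the Fisher-Rao metric, up to the factor 4
    (∀ (k : ℕ) (E : Set (EuclideanSpace ℝ (Fin k)))
      (P : EuclideanSpace ℝ (Fin k) → DensityGeometry.Dens g),
      IsOpen E → DensityGeometry.IsSmoothInto g E P →
      DensityGeometry.IsStatisticalModel g E (fun s => DensityGeometry.density g (P s)) ∧
      ∀ s ∈ E, ∀ a b : EuclideanSpace ℝ (Fin k),
        DensityGeometry.IsHDotValue g (P s)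
          (DensityGeometry.modelTangent (fun s => DensityGeometry.density g (P s)) s a)
          (DensityGeometry.modelTangent (fun s => DensityGeometry.density g (P s)) s b)
          (DensityGeometry.hDotMetric g (P s)
            (DensityGeometry.modelTangent (fun s => DensityGeometry.density g (P s)) s a)
            (DensityGeometry.modelTangent (fun s => DensityGeometry.density g (P s)) s b)) ∧
        ∑ i, ∑ j, DensityGeometry.fisherRao g (fun s => DensityGeometry.density g (P s)) s i j *
            a i * b j =
          4 * DensityGeometry.hDotMetric g (P s)
            (DensityGeometry.modelTangent (fun s => DensityGeometry.density g (P s)) s a)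
            (DensityGeometry.modelTangent (fun s => DensityGeometry.density g (P s)) s b)) ∧
    -- the same for a smooth family of densities, wherever its tangent vectors lift to `Diff(M)`
    (∀ (k : ℕ) (E : Set (EuclideanSpace ℝ (Fin k))) (ρ : EuclideanSpace ℝ (Fin k) → M → ℝ),
      IsOpen E → DensityGeometry.IsStatisticalModel g E ρ →
      ∀ s ∈ E, ∀ p : DensityGeometry.Dens g, DensityGeometry.density g p = ρ s →
      ∀ (a b : EuclideanSpace ℝ (Fin k)) (r : ℝ),
        DensityGeometry.IsHDotValue g p (DensityGeometry.modelTangent ρ s a)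
          (DensityGeometry.modelTangent ρ s b) r →
        ∑ i, ∑ j, DensityGeometry.fisherRao g ρ s i j * a i * b j = 4 * r) := by
  refine ⟨fun p α β r r' h h' => ?_, fun k E P hE hP => ⟨hP.isStatisticalModel, fun s hs a b => ?_⟩,
    fun k E ρ hE hρ s hs p hp a b r hr => hρ.sum_fisherRao_eq hE hs hp hr⟩
  · rw [h.eq_integral, h'.eq_integral]
  · have h := DensityGeometry.isHDotValue_hDotMetric (hP.exists_isHDotValue hE hs a b)
    -- Since lifts exist, the chosen value of `hDotMetric` is a genuine one and not the default
    -- zero.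
    exact ⟨h, hP.isStatisticalModel.sum_fisherRao_eq hE hs rfl h⟩
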